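/- Let $\mathcal S,\mathcal A$ be finite non-empty sets, $r:\mathcal S\times\mathcal A\times\mathcal S\to\mathbb R$ a reward function, $\gamma\in[0,1)$ a discount factor and $p^c=(p^c_{s,a})$ the (unknown) transition probabilities of the real MDP. *Observations.* At the beginning of stage $t=1,2,\dots$ a batch of $n(t)\ge 0$ random transitions $(s_{t,i},a_{t,i},s'_{t,i})$, $1\le i\le n(t)$, arrives. States and actions are chosen by an arbitrary behavior policy; given all earlier transitions and $(s_{t,i},a_{t,i})$, the successor $s'_{t,i}$ has law $p^c_{s_{t,i},a_{t,i}}$. The observations do not depend on the learning process. *Algorithm 1 (multi-stage Bayesian risk-averse Q-learning, without termination).* Inputs: Dirichlet prior parameters $\phi^0_{s,a}(s')>0$, numbers of updates $m(t)\ge 0$ with $\sum_t m(t)=\infty$, learning rates $\lambda_k\in[0,1]$ with $\sum_k\lambda_k=\infty$ and $\sum_k\lambda_k^2<\infty$, a minimal sample size $N\ge 1$, a level $\alpha\in(0,1)$ and a risk functional $\rho\in\{\mathrm{VaR}_\alpha,\mathrm{CVaR}_\alpha\}$. Start with $\phi=\phi^0$, $Q_0=0$ and $N_{s,a}=N$.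 In stage $t$, for each transition of the batch in turn, add $1$ to $\phi_{s,a}(s')$ if it equals $(s,a,s')$; for each pair $(s,a)$ replace $N_{s,a}$ by $N_{s,a}+1$ if $\phi_{s,a}$ did not change, and by $\max\{N_{s,a}-1,N\}$ if it did. Call the resulting parameters $\phi^t$. Then carry out $m(t)$ updates of the Q-function. In the $k$-th update (counted over all stages), for each $(s,a)$ draw $p_1,\dots,p_{N_{s,a}}$ from $\mathrm{Dirichlet}(\phi^t_{s,a})$, independently for all indices and pairs given the observations and all earlier samples, put $$X_i=\sum_{s'}p_i(s')\Big[r(s,a,s')+\gamma\max_{b}Q(s',b)\Big],\qquad n=N_{s,a},$$ and set, simultaneously for all $(s,a)$, $$Q(s,a)\leftarrow(1-\lambda_k)Q(s,a)+\lambda_k\widehat T,\qquad \widehat T=\begin{cases}X_{\lceil n\alpha\rceil:n}&\text{if }\rho=\mathrm{VaR}_\alpha,\\ \frac1{\lceil n\alpha\rceil}\sum_{j=1}^{\lceil n\alpha\rceil}X_{j:n}&\text{if }\rho=\mathrm{CVaR}_\alpha,\end{cases}$$ where $X_{j:n}$ is the $j$-th smallest of $X_1,\dots,X_n$. Let $Q_t$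 be the Q-function at the end of stage $t$. *Claim.* Let $O^\infty_{s,a,s'}\in\{0,1,\dots,\infty\}$ be the total number of observations of $(s,a,s')$. If almost surely $\max_{s'}O^\infty_{s,a,s'}=\infty$ for all $(s,a)\in\mathcal S\times\mathcal A$, then $$\lim_{t\to\infty}\|Q_t-Q^{c,*}\|_\infty=0\quad\text{almost surely},$$ where $Q^{c,*}$, the true optimal Q-function, is the unique solution of $$Q^{c,*}(s,a)=\sum_{s'\in\mathcal S}p^c_{s,a}(s')\Big[r(s,a,s')+\gamma\max_{b\in\mathcal A}Q^{c,*}(s',b)\Big]\quad\text{for all }(s,a).$$ -/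

import Mathlib

open MeasureTheory ProbabilityTheory Filter Topology

noncomputable section

namespace BRQL

/-- The two risk functionals: value at risk and conditional value at risk. -/
inductive Risk where
  | var
  | cvar

/-- The inputs of the multi-stage Bayesian risk-averse Q-learning algorithm, which is run without
termination. Sequences start at index `0`: `batchSize t` and `steps t` belong to stage `t + 1`,
and `rate k` is the learning rate of the `(k + 1)`-st Q-learning update, counted over all stages. -/
structure Input (S A : Type*) where
  /-- the reward `r(s, a, s')` -/
  reward : S → A → S → ℝ
  /-- the discount factor -/
  discount : ℝ
  /-- the number of real-world observations that arrive at the beginning of a stage -/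
  batchSize : ℕ → ℕ
  /-- the number of Q-learning updates in a stage -/
  steps : ℕ → ℕ
  /-- the learning rates -/
  rate : ℕ → ℝ
  /-- the parameters of the Dirichlet prior on the transition law of each state-action pair -/
  prior : S → A → S → ℝ
  /-- the minimal Monte Carlo sample size -/
  minSize : ℕ
  /-- the risk functional -/
  risk : Risk
  /-- the risk level -/
  level : ℝ

section Dirichlet

variable {S : Type*} [Fintype S]

open Classical in
/-- The point of the hyperplane `∑ s, p s = 1` whose coordinates other than `s₀` are `u`. -/
def simplexPoint (s₀ : S) (u : {s : S // s ≠ s₀} → ℝ) : S → ℝ :=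
  fun s => if h : s = s₀ then 1 - ∑ i, u i else u ⟨s, h⟩

variable [Nonempty S]

open Classical in
/-- Lebesgue measure on the probability simplex, in all coordinates but one (the choice of the
omitted coordinate does not affect the measure). -/
def simplexVolume : Measure (S → ℝ) :=
  ((volume : Measure ({s : S // s ≠ Classical.arbitrary S} → ℝ)).map
    (simplexPoint (Classical.arbitrary S))).restrict (stdSimplex ℝ S)

/-- The measure on the simplex with the density `∏ s, p s ^ (φ s - 1)`. -/
def dirichletWeight (φ : S → ℝ) : Measure (S → ℝ) :=
  simplexVolume.withDensity fun p => ENNReal.ofReal (∏ s, p s ^ (φ s - 1))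

/-- The Dirichlet distribution with parameter vector `φ`: the probability measure on the simplex
with density proportional to `∏ s, p s ^ (φ s - 1)`. -/
def dirichlet (φ : S → ℝ) : Measure (S → ℝ) :=
  (dirichletWeight φ Set.univ)⁻¹ • dirichletWeight φ

end Dirichlet

section Algorithm

variable {S A : Type*}

/-- The current Dirichlet parameters and Monte Carlo sample sizes of all state-action pairs. -/
structure Model (S A : Type*) where
  /-- Dirichlet parameters -/
  param : S → A → S → ℝ
  /-- sample sizes -/
  size : S → A → ℕ

/-- The initial model. -/
def initialModel (C : Input S A) : Model S A where
  param := C.prior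
  size := fun _ _ => C.minSize

open Classical in
/-- Bayesian update of the Dirichlet parameters by one observed transition `o`. -/
def updateParam (φ : S → A → S → ℝ) (o : S × A × S) : S → A → S → ℝ :=
  fun s a s' => φ s a s' + if o = (s, a, s') then 1 else 0

open Classical in
/-- Processing one observed transition: the parameters are updated; the sample size of a pair
whose parameters did not change grows by one, otherwise it decreases by one, but not below the
minimal size. -/
def observe (C : Input S A) (M : Model S A) (o : S × A × S) : Model S A where
  param := updateParam M.param o
  size := fun s a =>
    if updateParam M.param o s a = M.param s a then M.size s a + 1
    else max (M.size s a - 1) C.minSize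

/-- The model in stage `t` (the initial one for `t = 0`), given the observations `z`: the batch
`z t 0, …, z t (batchSize t - 1)` is processed at the beginning of stage `t + 1`. -/
def model (C : Input S A) (z : ℕ → ℕ → S × A × S) : ℕ → Model S A
  | 0 => initialModel C
  | t + 1 => (List.range (C.batchSize t)).foldl (fun M i => observe C M (z t i)) (model C z t)

/-- The number of Q-learning updates that are carried out in the first `t` stages. -/
def stepsBefore (C : Input S A) (t : ℕ) : ℕ := ∑ τ ∈ Finset.range t, C.steps τ

/-- `f(p | s, a, Q) = ∑ s', p(s') (r(s, a, s') + γ max_b Q(s', b))`. -/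
def backup [Fintype S] (r : S → A → S → ℝ) (γ : ℝ) (Q : S → A → ℝ) (s : S) (a : A)
    (p : S → ℝ) : ℝ :=
  ∑ s', p s' * (r s a s' + γ * ⨆ b, Q s' b)

/-- The `k`-th smallest (`1 ≤ k ≤ N`) of the numbers `X 0, …, X (N - 1)`. -/
def orderStat {N : ℕ} (X : Fin N → ℝ) (k : ℕ) : ℝ :=
  if h : k - 1 < N then X (Tuple.sort X ⟨k - 1, h⟩) else 0

/-- The Monte Carlo estimators of `VaR_α` and `CVaR_α` from the sample `X`. -/
def riskEstimate (ρ : Risk) (α : ℝ) {N : ℕ} (X : Fin N → ℝ) : ℝ :=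
  match ρ with
  | .var => orderStat X ⌈(N : ℝ) * α⌉₊
  | .cvar => (∑ k ∈ Finset.Icc 1 ⌈(N : ℝ) * α⌉₊, orderStat X k) / (⌈(N : ℝ) * α⌉₊ : ℝ)

/-- One Q-learning update with learning rate `η`, where `p s a j` is the `(j + 1)`-st sampled
transition law for the pair `(s, a)`; only the first `size s a` of them are used. -/
def qUpdate [Fintype S] (C : Input S A) (size : S → A → ℕ) (η : ℝ) (p : S → A → ℕ → S → ℝ)
    (Q : S → A → ℝ) : S → A → ℝ :=
  fun s a => (1 - η) * Q s a + η * riskEstimate C.risk C.level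
    (fun j : Fin (size s a) => backup C.reward C.discount Q s a (p s a j))

/-- The Q-function at the end of stage `t` (the zero function for `t = 0`), given the observations
`z` and the samples `p k s a j` that are drawn for the `(k + 1)`-st update. -/
def qFunction [Fintype S] (C : Input S A) (z : ℕ → ℕ → S × A × S)
    (p : ℕ → S → A → ℕ → S → ℝ) : ℕ → S → A → ℝ
  | 0 => fun _ _ => 0
  | t + 1 => (List.range (C.steps t)).foldl
      (fun Q l => qUpdate C (model C z (t + 1)).size (C.rate (stepsBefore C t + l))
        (p (stepsBefore C t + l)) Q)
      (qFunction C z p t)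

/-- `Q` solves the Bellman optimality equation of the Markov decision process with transition
probabilities `pc`, reward `r` and discount factor `γ`. -/
def IsOptimalQ [Fintype S] (r : S → A → S → ℝ) (γ : ℝ) (pc : S → A → S → ℝ)
    (Q : S → A → ℝ) : Prop :=
  ∀ s a, Q s a = ∑ s', pc s a s' * (r s a s' + γ * ⨆ b, Q s' b)

open Classical in
/-- The total number of observations of the transition `(s, a, s')` in the batches `z`. -/
def totalCount (C : Input S A) (z : ℕ → ℕ → S × A × S) (s : S) (a : A) (s' : S) : ENNReal :=
  ∑' t, ∑ i ∈ Finset.range (C.batchSize t), if z t i = (s, a, s') then 1 else 0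

end Algorithm

section Randomness

variable {S A Ω : Type*}

/-- The information in the observations that precede the `i`-th one of batch `t`, together with
its own state and action (but not its successor state). -/
abbrev pastObservations (C : Input S A) (Z : ℕ → ℕ → Ω → S × A × S) (t i : ℕ) :
    MeasurableSpace Ω :=
  (⨆ (t' : ℕ) (i' : ℕ) (_ : i' < C.batchSize t' ∧ (t' < t ∨ (t' = t ∧ i' < i))),
      MeasurableSpace.comap (Z t' i') ⊤) ⊔
    MeasurableSpace.comap (fun ω => ((Z t i ω).1, (Z t i ω).2.1)) ⊤

/-- `Z` is a stream of transitions of the environment with transition probabilities `pc`: given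
the earlier observations and the present state and action, the successor state has the law
`pc s a`. The choice of states and actions is arbitrary. -/
structure IsObservationStream [MeasurableSpace Ω] (μ : Measure Ω) (C : Input S A)
    (pc : S → A → S → ℝ) (Z : ℕ → ℕ → Ω → S × A × S) : Prop where
  measurableSet : ∀ t i, i < C.batchSize t → ∀ o, MeasurableSet {ω | Z t i ω = o}
  law : ∀ t i, i < C.batchSize t → ∀ x : S,
    μ⟦{ω | (Z t i ω).2.2 = x} | pastObservations C Z t i⟧
      =ᵐ[μ] fun ω => pc (Z t i ω).1 (Z t i ω).2.1 x

/-- The information in the whole observation stream and in the samples that were drawn for the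
updates `0, …, k - 1`. -/
abbrev pastSamples (C : Input S A) (Z : ℕ → ℕ → Ω → S × A × S)
    (P : ℕ → S → A → ℕ → Ω → S → ℝ) (k : ℕ) : MeasurableSpace Ω :=
  (⨆ (t : ℕ) (i : ℕ) (_ : i < C.batchSize t), MeasurableSpace.comap (Z t i) ⊤) ⊔
    ⨆ (k' : ℕ) (_ : k' < k) (s : S) (a : A) (j : ℕ),
      MeasurableSpace.comap (P k' s a j) inferInstance

/-- `P` are Monte Carlo samples as drawn by the algorithm: given the observation stream (which does
not depend on the learning process) and the samples of earlier updates, the samples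
`P k s a j`, `j < N s a`, for an update `k` in stage `t + 1` are independent, and
`P k s a j` has the Dirichlet posterior distribution of the pair `(s, a)` in that stage. -/
structure IsPosteriorSampling [Fintype S] [Nonempty S] [Fintype A] [MeasurableSpace Ω]
    (μ : Measure Ω) (C : Input S A) (Z : ℕ → ℕ → Ω → S × A × S)
    (P : ℕ → S → A → ℕ → Ω → S → ℝ) : Prop where
  measurable : ∀ k s a j, Measurable (P k s a j)
  law : ∀ t l, l < C.steps t → ∀ B : S → A → ℕ → Set (S → ℝ),
    (∀ s a j, MeasurableSet (B s a j)) →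
    μ⟦{ω | ∀ s a, ∀ j < (model C (fun t i => Z t i ω) (t + 1)).size s a,
        P (stepsBefore C t + l) s a j ω ∈ B s a j} | pastSamples C Z P (stepsBefore C t + l)⟧
      =ᵐ[μ] fun ω => ∏ s, ∏ a,
        ∏ j ∈ Finset.range ((model C (fun t i => Z t i ω) (t + 1)).size s a),
          (dirichlet ((model C (fun t i => Z t i ω) (t + 1)).param s a)).real (B s a j)

end Randomness

end BRQL

end

noncomputable section

namespace BRQL

/-! ### Deterministic averaging recursions -/

section Recursion

/-! Fix `ε > 0`. Let `e k` be the sup-norm error after `k` updates and `K` the constant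
`backupBound` at the true optimum. At every fixed transition law the backup is a `γ`-contraction in
`Q`. So a sampled law `ε`-close to the true one gives a value within `γ * e k + K * ε` of the
optimal one, and any other sampled law costs at most `K` more. Of `n` samples at least `n * α` have
rank at most `⌈n * α⌉` and at least `n * (1 - α)` have rank at least that. A Markov-type count then
shows that a fraction `F k` of bad samples moves VaR or CVaR by at most `K * F k / min α (1 - α)`
(`abs_riskEstimate_sub_le`). Summing `F k` over the pairs, this gives `e (k + 1) ≤ (1 - (1 - γ) * λ
k) * e k + λ k * (K * ε + const * F k)`. The sample size need not grow: the risk correction vanishes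
because the posterior concentrates.

Each fraction of bad samples has as conditional mean the posterior mass away from the true law,
which tends to zero. Its fluctuations, weighted by `λ k`, sum to an `L²`-bounded martingale because
`∑ λ k ^ 2 < ∞` (`ae_tendsto_sum_missFraction`). Hence `tendsto_of_averaging_add` gives `limsup e k
≤ K * ε / (1 - γ)`, and `ε → 0` finishes.

Concentration of the posterior (`ae_tendsto_dirichlet_model`) uses the same two tools. The posterior
mean of a pair is itself a stochastic approximation with step `1 / (Φ + 1)` at each visit, `Φ` being
the total Dirichlet parameter, so it converges to the true law. The Dirichlet moments and
Chebyshev's inequality do the rest. -/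

theorem abs_le_of_averaging {v a h : ℕ → ℝ} {δ : ℝ} {k : ℕ}
    (ha₀ : ∀ n, 0 ≤ a n) (ha₁ : ∀ n, a n ≤ 1) (hδ : ∀ n, k ≤ n → |h n| ≤ δ)
    (hv : ∀ n, v (n + 1) = (1 - a n) * v n + a n * h n) (n : ℕ) (hn : k ≤ n) :
    |v n| ≤ δ + |v k| *
      Real.exp (∑ i ∈ Finset.range k, a i - ∑ i ∈ Finset.range n, a i) := by
  induction n, hn using Nat.le_induction with
  | base =>
    have := (abs_nonneg _).trans (hδ k le_rfl)
    simp [this]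
  | succ n hn ih =>
    set e := Real.exp (∑ i ∈ Finset.range k, a i - ∑ i ∈ Finset.range n, a i)
    have h1 : Real.exp (∑ i ∈ Finset.range k, a i - ∑ i ∈ Finset.range (n + 1), a i)
        = e * Real.exp (-a n) := by
      rw [← Real.exp_add, Finset.sum_range_succ]
      ring_nf
    have h2 : 1 - a n ≤ Real.exp (-a n) := by
      have := Real.add_one_le_exp (-a n)
      linarith
    have h3 : 0 ≤ |v k| * e := by positivity
    calc |v (n + 1)| ≤ (1 - a n) * |v n| + a n * |h n| := by
          rw [hv]
          refine (abs_add_le _ _).trans (le_of_eq ?_)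
          rw [abs_mul, abs_mul, abs_of_nonneg (ha₀ n), abs_of_nonneg (sub_nonneg.2 (ha₁ n))]
      _ ≤ (1 - a n) * (δ + |v k| * e) + a n * δ := by
          have := sub_nonneg.2 (ha₁ n)
          have := ha₀ n
          have := hδ n hn
          gcongr
      _ = δ + (1 - a n) * (|v k| * e) := by ring
      _ ≤ δ + Real.exp (-a n) * (|v k| * e) := by gcongr
      _ = _ := by rw [h1]; ring

/-- Once `h` has become small, the previous bound applies from that time on, and divergence of `∑ a`
makes the recursion forget its past. -/
theorem tendsto_zero_of_averaging {v a h : ℕ → ℝ} (ha₀ : ∀ n, 0 ≤ a n) (ha₁ : ∀ n, a n ≤ 1)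
    (ha : Tendsto (fun n => ∑ i ∈ Finset.range n, a i) atTop atTop)
    (hh : Tendsto h atTop (𝓝 0)) (hv : ∀ n, v (n + 1) = (1 - a n) * v n + a n * h n) :
    Tendsto v atTop (𝓝 0) := by
  rw [Metric.tendsto_atTop]
  intro ε hε
  obtain ⟨k, hk⟩ := Metric.tendsto_atTop.1 hh (ε / 2) (half_pos hε)
  have h1 : Tendsto (fun n => |v k| *
      Real.exp (∑ i ∈ Finset.range k, a i - ∑ i ∈ Finset.range n, a i)) atTop (𝓝 0) := by
    have : Tendsto (fun n => ∑ i ∈ Finset.range k, a i - ∑ i ∈ Finset.range n, a i) atTop atBot :=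
      tendsto_atBot_add_const_left _ _ (tendsto_neg_atTop_atBot.comp ha)
    simpa using (Real.tendsto_exp_atBot.comp this).const_mul |v k|
  obtain ⟨l, hl⟩ := Metric.tendsto_atTop.1 h1 (ε / 2) (half_pos hε)
  refine ⟨max k l, fun n hn => ?_⟩
  have h2 := abs_le_of_averaging (δ := ε / 2) ha₀ ha₁
    (fun n hn => by simpa using (hk n hn).le) hv n (le_of_max_le_left hn)
  have h3 := hl n (le_of_max_le_right hn)
  rw [Real.dist_eq, sub_zero] at h3 ⊢
  linarith [le_abs_self (|v k| *
      Real.exp (∑ i ∈ Finset.range k, a i - ∑ i ∈ Finset.range n, a i))]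

/-- A stochastic approximation scheme on the real line, for one realization of the noise. -/
theorem tendsto_of_averaging_add {w a g b : ℕ → ℝ} {l c : ℝ}
    (ha₀ : ∀ n, 0 ≤ a n) (ha₁ : ∀ n, a n ≤ 1)
    (ha : Tendsto (fun n => ∑ i ∈ Finset.range n, a i) atTop atTop)
    (hg : Tendsto g atTop (𝓝 l))
    (hb : Tendsto (fun n => ∑ i ∈ Finset.range n, b i) atTop (𝓝 c))
    (hw : ∀ n, w (n + 1) = (1 - a n) * w n + a n * g n + b n) :
    Tendsto w atTop (𝓝 l) := by
  -- Subtracting the centred partial sums of `b` absorbs the noise: `w - l - B` is averaged against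
  -- `g - l - B`, which tends to zero. Convergence of the series suffices; it need not be absolute.
  set B : ℕ → ℝ := fun n => ∑ i ∈ Finset.range n, b i - c with hB
  have hB0 : Tendsto B atTop (𝓝 0) := by simpa [hB] using hb.sub_const c
  have h := tendsto_zero_of_averaging (v := fun n => w n - l - B n)
    (h := fun n => g n - l - B n) ha₀ ha₁ ha (by simpa using (hg.sub_const l).sub hB0)
    (fun n => by
      simp only [hw, hB, Finset.sum_range_succ]
      ring)
  simpa using (h.add hB0).add_const l

end Recursion

/-! ### Stages cut into single steps -/

section Flattening

/-- The block of index `m` if `ℕ` is cut into consecutive blocks of sizes `c 0, c 1, …`. -/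
def blockOf (c : ℕ → ℕ) (m : ℕ) : ℕ := sInf {t | m < ∑ τ ∈ Finset.range (t + 1), c τ}

theorem blockOf_add {c : ℕ → ℕ} {t l : ℕ} (hl : l < c t) :
    blockOf c (∑ τ ∈ Finset.range t, c τ + l) = t := by
  refine le_antisymm (Nat.sInf_le ?_) (le_csInf ⟨t, ?_⟩ fun t' ht' => ?_)
  · simpa [Finset.sum_range_succ] using hl
  · simpa [Finset.sum_range_succ] using hl
  · by_contra! h
    have : ∑ τ ∈ Finset.range (t' + 1), c τ ≤ ∑ τ ∈ Finset.range t, c τ :=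
      Finset.sum_le_sum_of_subset (Finset.range_subset_range.2 h)
    simp only [Set.mem_ofPred_eq] at ht'
    omega

/-- Divergence ensures that `blockOf` is the infimum of a nonempty set; otherwise it would be the
default value `0`. -/
theorem exists_eq_block_add {c : ℕ → ℕ}
    (hc : Tendsto (fun t => ∑ τ ∈ Finset.range t, c τ) atTop atTop) (m : ℕ) :
    ∃ l < c (blockOf c m), m = ∑ τ ∈ Finset.range (blockOf c m), c τ + l := by
  have hne : {t | m < ∑ τ ∈ Finset.range (t + 1), c τ}.Nonempty :=
    (((tendsto_add_atTop_iff_nat 1).2 hc).eventually_gt_atTop m).exists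
  have h1 : m < ∑ τ ∈ Finset.range (blockOf c m + 1), c τ := Nat.sInf_mem hne
  have h2 : ∑ τ ∈ Finset.range (blockOf c m), c τ ≤ m := by
    rcases Nat.eq_zero_or_pos (blockOf c m) with h0 | h0
    · simp [h0]
    · obtain ⟨t, ht⟩ := Nat.exists_eq_succ_of_ne_zero h0.ne'
      have : t ∉ {t | m < ∑ τ ∈ Finset.range (t + 1), c τ} :=
        Nat.notMem_of_lt_sInf (by change t < blockOf c m; omega)
      rw [ht]
      simpa using this
  rw [Finset.sum_range_succ] at h1
  exact ⟨m - ∑ τ ∈ Finset.range (blockOf c m), c τ, by omega, by omega⟩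

theorem tendsto_blockOf {c : ℕ → ℕ}
    (hc : Tendsto (fun t => ∑ τ ∈ Finset.range t, c τ) atTop atTop) :
    Tendsto (blockOf c) atTop atTop := by
  refine tendsto_atTop.2 fun T => ?_
  filter_upwards [eventually_ge_atTop (∑ τ ∈ Finset.range T, c τ)] with m hm
  obtain ⟨l, hl, h⟩ := exists_eq_block_add hc m
  by_contra! hT
  have : ∑ τ ∈ Finset.range (blockOf c m + 1), c τ ≤ ∑ τ ∈ Finset.range T, c τ :=
    Finset.sum_le_sum_of_subset (Finset.range_subset_range.2 hT)
  rw [Finset.sum_range_succ] at this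
  omega

/-- A process that makes `c t` steps in stage `t` is the one that makes one step at a time. -/
theorem eq_of_foldl_blocks {β : Type*} {c : ℕ → ℕ} {F : ℕ → ℕ → β → β} {x y : ℕ → β}
    (h0 : x 0 = y 0)
    (hx : ∀ t, x (t + 1) = (List.range (c t)).foldl (fun b l => F t l b) (x t))
    (hy : ∀ t l, l < c t → y (∑ τ ∈ Finset.range t, c τ + l + 1)
      = F t l (y (∑ τ ∈ Finset.range t, c τ + l))) (t : ℕ) :
    x t = y (∑ τ ∈ Finset.range t, c τ) := by
  induction t with
  | zero => simpa using h0
  | succ t ih =>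
    have key : ∀ n ≤ c t, (List.range n).foldl (fun b l => F t l b) (x t)
        = y (∑ τ ∈ Finset.range t, c τ + n) := by
      intro n hn
      induction n with
      | zero => simpa using ih
      | succ n ihn =>
        rw [List.range_succ, List.foldl_append, ihn (by omega)]
        simpa [add_assoc] using (hy t n hn).symm
    rw [hx, key _ le_rfl, Finset.sum_range_succ]

end Flattening

/-! ### Convergence of martingale series -/

section MartingaleDifference

variable {Ω : Type*} {m0 : MeasurableSpace Ω} {μ : Measure Ω} [IsProbabilityMeasure μ]

/-- A series of bounded martingale differences with summable variances converges almost surely. -/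
theorem ae_tendsto_sum_of_condExp_eq_zero (ℱ : Filtration ℕ m0) {x : ℕ → Ω → ℝ} {c : ℕ → ℝ}
    (hx : ∀ n, StronglyMeasurable[ℱ (n + 1)] (x n)) (hc : ∀ n ω, |x n ω| ≤ c n)
    (h0 : ∀ n, μ[x n | ℱ n] =ᵐ[μ] 0) {R : ℝ}
    (hR : ∀ n ω, ∑ i ∈ Finset.range n, x i ω ^ 2 ≤ R) :
    ∀ᵐ ω ∂μ, ∃ l, Tendsto (fun n => ∑ i ∈ Finset.range n, x i ω) atTop (𝓝 l) := by
  set f : ℕ → Ω → ℝ := fun n ω => ∑ i ∈ Finset.range n, x i ω with hf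
  have hxm : ∀ n, StronglyMeasurable (x n) := fun n => (hx n).mono (ℱ.le _)
  have hfa : ∀ n, StronglyMeasurable[ℱ n] (f n) := fun n =>
    Finset.stronglyMeasurable_fun_sum _ fun i hi =>
      (hx i).mono (ℱ.mono (Finset.mem_range.1 hi))
  have hfb : ∀ n ω, |f n ω| ≤ ∑ i ∈ Finset.range n, c i := fun n ω =>
    (Finset.abs_sum_le_sum_abs _ _).trans (Finset.sum_le_sum fun i _ => hc i ω)
  have hxi : ∀ n, Integrable (x n) μ := fun n =>
    Integrable.of_bound (hxm n).aestronglyMeasurable (c n) (ae_of_all _ (hc n))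
  have hfi : ∀ n, Integrable (f n) μ := fun n => integrable_finsetSum _ fun i _ => hxi i
  have hmart : Martingale f ℱ μ := by
    refine martingale_of_condExp_sub_eq_zero_nat hfa hfi fun n => ?_
    have : f (n + 1) - f n = x n := by
      ext ω
      simp [hf, Finset.sum_range_succ]
    rw [this]
    exact h0 n
  have hfx : ∀ n, Integrable (f n * x n) μ := fun n =>
    Integrable.of_bound (((hfa n).mono (ℱ.le _)).mul (hxm n)).aestronglyMeasurable
      ((∑ i ∈ Finset.range n, c i) * c n) (ae_of_all _ fun ω => by
        rw [Pi.mul_apply, norm_mul]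
        exact mul_le_mul (hfb n ω) (hc n ω) (abs_nonneg _) ((abs_nonneg _).trans (hfb n ω)))
  -- Each increment is orthogonal to the past, so second moments of the increments add up.
  have hcross : ∀ n, ∫ ω, f n ω * x n ω ∂μ = 0 := by
    intro n
    have h1 := condExp_mul_of_stronglyMeasurable_left (hfa n) (hfx n) (hxi n)
    have h2 : μ[f n * x n | ℱ n] =ᵐ[μ] 0 := by
      filter_upwards [h1, h0 n] with ω hω hω'
      rw [hω, Pi.mul_apply, hω']
      simp
    have h3 := integral_condExp (μ := μ) (f := f n * x n) (ℱ.le n)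
    rw [integral_congr_ae h2] at h3
    simpa using h3.symm
  have hx2 : ∀ n, Integrable (fun ω => x n ω ^ 2) μ := fun n =>
    Integrable.of_bound ((hxm n).pow 2).aestronglyMeasurable (c n ^ 2) (ae_of_all _ fun ω => by
      rw [norm_pow]
      exact pow_le_pow_left₀ (abs_nonneg _) (hc n ω) 2)
  have hf2 : ∀ n, Integrable (fun ω => f n ω ^ 2) μ := fun n =>
    Integrable.of_bound (((hfa n).mono (ℱ.le _)).pow 2).aestronglyMeasurable
      ((∑ i ∈ Finset.range n, c i) ^ 2) (ae_of_all _ fun ω => by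
        rw [norm_pow]
        exact pow_le_pow_left₀ (abs_nonneg _) (hfb n ω) 2)
  have hvar : ∀ n, ∫ ω, f n ω ^ 2 ∂μ = ∫ ω, ∑ i ∈ Finset.range n, x i ω ^ 2 ∂μ := by
    intro n
    induction n with
    | zero => simp [hf]
    | succ n ih =>
      have e1 : ∀ ω, f (n + 1) ω ^ 2 = f n ω ^ 2 + (2 * (f n ω * x n ω) + x n ω ^ 2) := fun ω => by
        simp only [hf, Finset.sum_range_succ]
        ring
      have hfx' : Integrable (fun ω => 2 * (f n ω * x n ω)) μ := (hfx n).const_mul 2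
      have hs : Integrable (fun ω => 2 * (f n ω * x n ω) + x n ω ^ 2) μ := hfx'.add (hx2 n)
      simp_rw [e1, Finset.sum_range_succ]
      rw [integral_add (hf2 n) hs, integral_add hfx' (hx2 n),
        integral_const_mul, hcross, ih,
        integral_add (integrable_finsetSum _ fun i _ => hx2 i) (hx2 n)]
      ring
  -- The inequality `|f| ≤ 1 + f ^ 2` turns the `L²` bound `R` into the `L¹` bound that
  -- submartingale convergence asks for.
  have hbd : ∀ n, eLpNorm (f n) 1 μ ≤ ((1 + R).toNNReal : ENNReal) := by
    intro n
    rw [eLpNorm_one_eq_lintegral_enorm, ← ofReal_integral_norm_eq_lintegral_enorm (hfi n)]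
    refine ENNReal.ofReal_le_ofReal ?_
    have h1 : ∫ ω, ‖f n ω‖ ∂μ ≤ ∫ ω, (1 + f n ω ^ 2) ∂μ := by
      refine integral_mono (hfi n).norm ((integrable_const _).add (hf2 n)) fun ω => ?_
      simp only [Real.norm_eq_abs]
      nlinarith [sq_nonneg (|f n ω| - 1), sq_abs (f n ω), abs_nonneg (f n ω)]
    have h2 : ∫ ω, ∑ i ∈ Finset.range n, x i ω ^ 2 ∂μ ≤ ∫ _, R ∂μ :=
      integral_mono (integrable_finsetSum _ fun i _ => hx2 i) (integrable_const _) (hR n)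
    rw [integral_add (integrable_const _) (hf2 n), hvar] at h1
    simp only [integral_const, probReal_univ, smul_eq_mul, one_mul] at h1 h2
    linarith
  exact hmart.submartingale.exists_ae_tendsto_of_bdd hbd

end MartingaleDifference

/-! ### Dirichlet's integral by way of gamma densities -/

section DirichletIntegral

/-- The density `x ^ (a - 1)` on the nonnegative half line. -/
def powerWeight (a x : ℝ) : ENNReal := if 0 ≤ x then ENNReal.ofReal (x ^ (a - 1)) else 0

theorem measurable_powerWeight (a : ℝ) : Measurable (powerWeight a) :=
  Measurable.ite measurableSet_Ici (by fun_prop) measurable_const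

theorem measurable_gammaPDF (a r : ℝ) : Measurable (gammaPDF a r) :=
  (measurable_gammaPDFReal a r).ennreal_ofReal

theorem gammaPDF_one_eq {a : ℝ} (ha : 0 < a) (x : ℝ) :
    gammaPDF a 1 x = ENNReal.ofReal (Real.Gamma a)⁻¹ *
      (ENNReal.ofReal (Real.exp (-x)) * powerWeight a x) := by
  have := Real.Gamma_pos_of_pos ha
  rw [gammaPDF_eq, powerWeight]
  split_ifs with h
  · rw [← ENNReal.ofReal_mul (by positivity), ← ENNReal.ofReal_mul (by positivity)]
    congr 1
    simp
    ring
  · simp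

theorem powerWeight_mul {a r x : ℝ} (hr : 0 < r) :
    powerWeight a (r * x) = ENNReal.ofReal (r ^ (a - 1)) * powerWeight a x := by
  unfold powerWeight
  by_cases h : 0 ≤ x
  · rw [if_pos (by positivity), if_pos h, Real.mul_rpow hr.le h,
      ENNReal.ofReal_mul (by positivity)]
  · rw [if_neg h, if_neg (by rw [mul_nonneg_iff_of_pos_left hr]; exact h), mul_zero]

variable {ι : Type*} [Fintype ι]

theorem lintegral_prod_gammaPDF {φ : ι → ℝ} (hφ : ∀ i, 0 < φ i) :
    ∫⁻ v : ι → ℝ, ∏ i, gammaPDF (φ i) 1 (v i) = 1 := by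
  have hn : ∀ i x, 0 ≤ gammaPDFReal (φ i) 1 x := fun i x =>
    gammaPDFReal_nonneg (hφ i) one_pos x
  have hint : ∀ i, Integrable (gammaPDFReal (φ i) 1) := fun i => by
    refine ⟨(stronglyMeasurable_gammaPDFReal _ _).aestronglyMeasurable, ?_⟩
    rw [hasFiniteIntegral_iff_ofReal (ae_of_all _ (hn i))]
    exact (lintegral_gammaPDF_eq_one (hφ i) one_pos).trans_lt ENNReal.one_lt_top
  have hone : ∀ i, ∫ x, gammaPDFReal (φ i) 1 x = 1 := fun i => by
    rw [integral_eq_lintegral_of_nonneg_ae (ae_of_all _ (hn i))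
      (stronglyMeasurable_gammaPDFReal _ _).aestronglyMeasurable]
    exact (congrArg _ (lintegral_gammaPDF_eq_one (hφ i) one_pos)).trans ENNReal.toReal_one
  have h1 : ∀ v : ι → ℝ, ∏ i, gammaPDF (φ i) 1 (v i)
      = ENNReal.ofReal (∏ i, gammaPDFReal (φ i) 1 (v i)) := fun v =>
    (ENNReal.ofReal_prod_of_nonneg fun i _ => hn i _).symm
  simp_rw [h1]
  have hpi : Integrable (fun v : ι → ℝ => ∏ i, gammaPDFReal (φ i) 1 (v i)) :=
    Integrable.fintype_prod hint
  rw [← ofReal_integral_eq_lintegral_ofReal hpi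
    (ae_of_all _ fun v => Finset.prod_nonneg fun i _ => hn i _),
    integral_fintype_prod_volume_eq_prod (fun i => gammaPDFReal (φ i) 1)]
  simp [hone]

/-- Substitute `v = r • u`: the volume contributes `r ^ card ι` and the weights `r ^ (∑ (φ i - 1) +
(b - 1))`. -/
theorem lintegral_prod_powerWeight_scale {φ : ι → ℝ} {b r : ℝ} (hr : 0 < r) :
    ∫⁻ v : ι → ℝ, (∏ i, powerWeight (φ i) (v i)) * powerWeight b (r - ∑ i, v i)
      = ENNReal.ofReal (r ^ (∑ i, φ i + b - 1)) *
        ∫⁻ u : ι → ℝ, (∏ i, powerWeight (φ i) (u i)) * powerWeight b (1 - ∑ i, u i) := by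
  have hmeas : Measurable fun v : ι → ℝ =>
      (∏ i, powerWeight (φ i) (v i)) * powerWeight b (r - ∑ i, v i) :=
    (Finset.measurable_fun_prod _ fun i _ =>
      (measurable_powerWeight _).comp (measurable_pi_apply i)).mul
      ((measurable_powerWeight _).comp (by fun_prop))
  have h1 : (volume : Measure (ι → ℝ)) = ENNReal.ofReal (r ^ Fintype.card ι) •
      Measure.map (r • ·) volume := by
    rw [Measure.map_addHaar_smul _ hr.ne', smul_smul, ← ENNReal.ofReal_mul (by positivity)]
    simp only [Module.finrank_fintype_fun_eq_card]
    rw [abs_of_nonneg (by positivity), mul_inv_cancel₀ (by positivity)]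
    simp
  conv_lhs => rw [h1]
  rw [lintegral_smul_measure, lintegral_map hmeas (measurable_const_smul r), smul_eq_mul]
  have h2 : ∀ u : ι → ℝ, (∏ i, powerWeight (φ i) ((r • u) i)) *
      powerWeight b (r - ∑ i, (r • u) i)
      = ENNReal.ofReal (r ^ (∑ i, (φ i - 1) + (b - 1))) *
        ((∏ i, powerWeight (φ i) (u i)) * powerWeight b (1 - ∑ i, u i)) := by
    intro u
    have e1 : r - ∑ i, (r • u) i = r * (1 - ∑ i, u i) := by
      simp [← Finset.mul_sum]
      ring
    rw [e1, powerWeight_mul hr]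
    simp_rw [Pi.smul_apply, smul_eq_mul, powerWeight_mul hr]
    rw [Finset.prod_mul_distrib, ← ENNReal.ofReal_prod_of_nonneg fun i _ => by positivity,
      ← Real.rpow_sum_of_pos hr, Real.rpow_add hr,
      ENNReal.ofReal_mul (by positivity)]
    ring
  simp_rw [h2]
  rw [lintegral_const_mul', ← mul_assoc, ← ENNReal.ofReal_mul (by positivity),
    ← Real.rpow_natCast, ← Real.rpow_add hr]
  · congr 3
    simp
    ring
  · exact ENNReal.ofReal_ne_top

/-- Dirichlet's integral. -/
theorem lintegral_prod_powerWeight {φ : ι → ℝ} {b : ℝ} (hφ : ∀ i, 0 < φ i) (hb : 0 < b) :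
    ∫⁻ u : ι → ℝ, (∏ i, powerWeight (φ i) (u i)) * powerWeight b (1 - ∑ i, u i)
      = ENNReal.ofReal ((∏ i, Real.Gamma (φ i)) * Real.Gamma b / Real.Gamma (∑ i, φ i + b)) := by
  set I := ∫⁻ u : ι → ℝ, (∏ i, powerWeight (φ i) (u i)) * powerWeight b (1 - ∑ i, u i) with hI
  set s := ∑ i, φ i + b with hs
  have hs0 : 0 < s := add_pos_of_nonneg_of_pos (Finset.sum_nonneg fun i _ => (hφ i).le) hb
  have hG : 0 < (∏ i, Real.Gamma (φ i)) * Real.Gamma b :=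
    mul_pos (Finset.prod_pos fun i _ => Real.Gamma_pos_of_pos (hφ i)) (Real.Gamma_pos_of_pos hb)
  have hGs := Real.Gamma_pos_of_pos hs0
  set c := ENNReal.ofReal ((∏ i, Real.Gamma (φ i)) * Real.Gamma b)⁻¹ with hc
  -- The joint density of independent gamma variables has mass one. Below, the same mass is computed
  -- by conditioning on their total `r`.
  have h1 : ∫⁻ v : ι → ℝ, ∫⁻ y : ℝ, (∏ i, gammaPDF (φ i) 1 (v i)) * gammaPDF b 1 y = 1 := by
    have : ∀ v : ι → ℝ, ∫⁻ y : ℝ, (∏ i, gammaPDF (φ i) 1 (v i)) * gammaPDF b 1 y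
        = ∏ i, gammaPDF (φ i) 1 (v i) := fun v => by
      rw [lintegral_const_mul _ (measurable_gammaPDF _ _),
        lintegral_gammaPDF_eq_one hb one_pos, mul_one]
    simp_rw [this]
    exact lintegral_prod_gammaPDF hφ
  have hprod : ∀ (v : ι → ℝ) (y : ℝ), (∏ i, gammaPDF (φ i) 1 (v i)) * gammaPDF b 1 y
      = c * (ENNReal.ofReal (Real.exp (-(∑ i, v i + y))) *
        ((∏ i, powerWeight (φ i) (v i)) * powerWeight b y)) := by
    intro v y
    simp_rw [gammaPDF_one_eq (hφ _), gammaPDF_one_eq hb]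
    rw [Finset.prod_mul_distrib, Finset.prod_mul_distrib,
      ← ENNReal.ofReal_prod_of_nonneg fun i _ =>
        inv_nonneg.2 (Real.Gamma_pos_of_pos (hφ i)).le,
      ← ENNReal.ofReal_prod_of_nonneg fun i _ => (Real.exp_pos _).le, ← Real.exp_sum, neg_add,
      Real.exp_add, ENNReal.ofReal_mul (Real.exp_pos _).le, hc, mul_inv, ENNReal.ofReal_mul,
      Finset.prod_inv_distrib, Finset.sum_neg_distrib]
    · ring
    · exact inv_nonneg.2 (Finset.prod_nonneg fun i _ => (Real.Gamma_pos_of_pos (hφ i)).le)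
  have h2 : ∀ v : ι → ℝ, ∫⁻ y : ℝ, (∏ i, gammaPDF (φ i) 1 (v i)) * gammaPDF b 1 y
      = ∫⁻ r : ℝ, c * (ENNReal.ofReal (Real.exp (-r)) *
        ((∏ i, powerWeight (φ i) (v i)) * powerWeight b (r - ∑ i, v i))) := by
    intro v
    rw [← lintegral_sub_right_eq_self _ (∑ i, v i)]
    refine lintegral_congr fun r => ?_
    rw [hprod, add_sub_cancel]
  have hmeas : Measurable (Function.uncurry fun (v : ι → ℝ) (r : ℝ) =>
      c * (ENNReal.ofReal (Real.exp (-r)) *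
        ((∏ i, powerWeight (φ i) (v i)) * powerWeight b (r - ∑ i, v i)))) := by
    refine measurable_const.mul (Measurable.mul (by fun_prop) (Measurable.mul ?_ ?_))
    · exact Finset.measurable_fun_prod _ fun i _ =>
        (measurable_powerWeight _).comp (by fun_prop)
    · exact (measurable_powerWeight _).comp (by fun_prop)
  -- By scaling, the total `r` has the density of a gamma variable of shape `s`, up to a constant
  -- containing `I`. Both sides vanish for `r < 0`, and the point `r = 0` is null. Integrating over
  -- `r` determines `I`.
  have h3 : ∀ r : ℝ, r ≠ 0 → ∫⁻ v : ι → ℝ, c * (ENNReal.ofReal (Real.exp (-r)) *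
        ((∏ i, powerWeight (φ i) (v i)) * powerWeight b (r - ∑ i, v i)))
      = (c * ENNReal.ofReal (Real.Gamma s) * I) * gammaPDF s 1 r := by
    intro r hr
    rw [lintegral_const_mul' _ _ ENNReal.ofReal_ne_top,
      lintegral_const_mul' _ _ ENNReal.ofReal_ne_top, gammaPDF_one_eq hs0]
    rcases hr.lt_or_gt with hr | hr
    · have : ∀ v : ι → ℝ, (∏ i, powerWeight (φ i) (v i)) * powerWeight b (r - ∑ i, v i) = 0 := by
        intro v
        by_cases h : ∀ i, 0 ≤ v i
        · have : ¬ 0 ≤ r - ∑ i, v i := by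
            have := Finset.sum_nonneg fun i (_ : i ∈ Finset.univ) => h i
            linarith
          simp [powerWeight, this]
        · push Not at h
          obtain ⟨i, hi⟩ := h
          rw [Finset.prod_eq_zero (Finset.mem_univ i) (by simp [powerWeight, hi]), zero_mul]
      simp_rw [this]
      simp [powerWeight, hr.not_ge]
    · have hGG : ENNReal.ofReal (Real.Gamma s) * ENNReal.ofReal (Real.Gamma s)⁻¹ = 1 := by
        rw [← ENNReal.ofReal_mul hGs.le, mul_inv_cancel₀ hGs.ne', ENNReal.ofReal_one]
      rw [lintegral_prod_powerWeight_scale hr, ← hs, ← hI, powerWeight, if_pos hr.le]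
      calc c * (ENNReal.ofReal (Real.exp (-r)) * (ENNReal.ofReal (r ^ (s - 1)) * I))
          = c * (ENNReal.ofReal (Real.exp (-r)) * (ENNReal.ofReal (r ^ (s - 1)) * I)) *
            (ENNReal.ofReal (Real.Gamma s) * ENNReal.ofReal (Real.Gamma s)⁻¹) := by
              rw [hGG, mul_one]
        _ = _ := by ring
  rw [lintegral_congr h2, lintegral_lintegral_swap hmeas.aemeasurable,
    lintegral_congr_ae ((Measure.ae_ne volume (0 : ℝ)).mono fun r hr => h3 r hr),
    lintegral_const_mul _ (measurable_gammaPDF _ _),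
    lintegral_gammaPDF_eq_one hs0 one_pos, mul_one, hc, ← ENNReal.ofReal_mul (by positivity)] at h1
  rw [mul_comm] at h1
  rw [ENNReal.eq_inv_of_mul_eq_one_left h1, ← ENNReal.ofReal_inv_of_pos (by positivity)]
  congr 1
  field_simp

end DirichletIntegral

/-! ### Normalization, moments and concentration of Dirichlet laws -/

section Dirichlet

variable {S : Type*} [Fintype S]

theorem sum_simplexPoint (s₀ : S) (u : {s : S // s ≠ s₀} → ℝ) : ∑ s, simplexPoint s₀ u s = 1 := by
  classical
  rw [← Finset.add_sum_erase _ _ (Finset.mem_univ s₀), Finset.sum_subtype (p := (· ≠ s₀)) _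
    (F := Subtype.fintype _) (by simp)]
  have : ∀ i : {s : S // s ≠ s₀}, simplexPoint s₀ u i = u i := fun i => by
    simp [simplexPoint, i.2]
  simp_rw [this]
  simp [simplexPoint]

theorem measurable_simplexPoint (s₀ : S) : Measurable (simplexPoint s₀) := by
  refine measurable_pi_lambda _ fun s => ?_
  unfold simplexPoint
  by_cases h : s = s₀
  · simp only [h, dite_true]
    fun_prop
  · simp only [h, dite_false]
    fun_prop

theorem measurableSet_stdSimplex : MeasurableSet (stdSimplex ℝ S) :=
  (isClosed_stdSimplex ℝ S).measurableSet

theorem measurable_dirichletDensity (φ : S → ℝ) :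
    Measurable fun p : S → ℝ => ENNReal.ofReal (∏ s, p s ^ (φ s - 1)) := by
  fun_prop

/-- The distributions on the simplex that are `ε`-close to `c` in every coordinate. -/
def simplexNhd (c : S → ℝ) (ε : ℝ) : Set (S → ℝ) :=
  stdSimplex ℝ S ∩ {p | ∀ s, |p s - c s| < ε}

theorem measurableSet_simplexNhd (c : S → ℝ) (ε : ℝ) : MeasurableSet (simplexNhd c ε) := by
  refine measurableSet_stdSimplex.inter ?_
  rw [Set.ofPred_forall]
  exact MeasurableSet.iInter fun s => measurableSet_lt (by fun_prop) measurable_const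

variable [Nonempty S]

/-- In the chart that omits the coordinate `s₀`, the density cut off to the simplex is a product of
`powerWeight`s, whose zero extension encodes the positivity constraints. This is Dirichlet's
integral. -/
theorem dirichletWeight_univ {φ : S → ℝ} (hφ : ∀ s, 0 < φ s) :
    dirichletWeight φ Set.univ =
      ENNReal.ofReal ((∏ s, Real.Gamma (φ s)) / Real.Gamma (∑ s, φ s)) := by
  classical
  set s₀ := Classical.arbitrary S
  have hsplit : ∀ {M : Type} [CommMonoid M] (f : S → M),
      ∏ s, f s = (∏ i : {s : S // s ≠ s₀}, f i) * f s₀ := fun f => by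
    rw [mul_comm, ← Finset.mul_prod_erase _ _ (Finset.mem_univ s₀),
      Finset.prod_subtype (p := (· ≠ s₀)) _ (by simp)]
  have hsum : ∑ s, φ s = ∑ i : {s : S // s ≠ s₀}, φ i + φ s₀ := by
    rw [add_comm, ← Finset.add_sum_erase _ _ (Finset.mem_univ s₀),
      Finset.sum_subtype (p := (· ≠ s₀)) _ (by simp)]
  rw [dirichletWeight, withDensity_apply _ MeasurableSet.univ, Measure.restrict_univ,
    simplexVolume, ← lintegral_indicator measurableSet_stdSimplex,
    lintegral_map ((measurable_dirichletDensity φ).indicator measurableSet_stdSimplex)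
      (measurable_simplexPoint _), hsplit, hsum,
    ← lintegral_prod_powerWeight (φ := fun i : {s : S // s ≠ s₀} => φ i) (fun i => hφ i) (hφ s₀)]
  refine lintegral_congr fun u => ?_
  have h1 : ∀ i : {s : S // s ≠ s₀}, simplexPoint s₀ u i = u i := fun i => by
    simp [simplexPoint, i.2]
  have h2 : simplexPoint s₀ u s₀ = 1 - ∑ i, u i := by
    simp only [simplexPoint, dite_true]
    congr!
  have h3 : (∏ i : {s : S // s ≠ s₀}, powerWeight (φ i) (u i)) * powerWeight (φ s₀) (1 - ∑ i, u i)
      = ∏ s, powerWeight (φ s) (simplexPoint s₀ u s) := by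
    rw [hsplit, h2]
    simp_rw [h1]
  rw [h3]
  by_cases h : ∀ s, 0 ≤ simplexPoint s₀ u s
  · rw [Set.indicator_of_mem (show simplexPoint s₀ u ∈ stdSimplex ℝ S from
      ⟨h, sum_simplexPoint s₀ u⟩),
      ENNReal.ofReal_prod_of_nonneg fun s _ => Real.rpow_nonneg (h s) _]
    exact Finset.prod_congr rfl fun s _ => by rw [powerWeight, if_pos (h s)]
  · rw [Set.indicator_of_notMem fun hmem => h hmem.1]
    push Not at h
    obtain ⟨s, hs⟩ := h
    exact (Finset.prod_eq_zero (Finset.mem_univ s) (by simp [powerWeight, hs])).symm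

variable {φ : S → ℝ}

theorem dirichletWeight_univ_ratio_pos (hφ : ∀ s, 0 < φ s) :
    0 < (∏ s, Real.Gamma (φ s)) / Real.Gamma (∑ s, φ s) :=
  div_pos (Finset.prod_pos fun s _ => Real.Gamma_pos_of_pos (hφ s))
    (Real.Gamma_pos_of_pos (Finset.sum_pos (fun s _ => hφ s) Finset.univ_nonempty))

theorem isProbabilityMeasure_dirichlet (hφ : ∀ s, 0 < φ s) :
    IsProbabilityMeasure (dirichlet φ) := by
  constructor
  rw [dirichlet, Measure.smul_apply, smul_eq_mul, ENNReal.inv_mul_cancel]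
  · rw [dirichletWeight_univ hφ, ENNReal.ofReal_ne_zero_iff]
    exact dirichletWeight_univ_ratio_pos hφ
  · rw [dirichletWeight_univ hφ]
    exact ENNReal.ofReal_ne_top

theorem ae_dirichlet_mem_stdSimplex (φ : S → ℝ) : ∀ᵐ p ∂dirichlet φ, p ∈ stdSimplex ℝ S := by
  refine Measure.ae_smul_measure ?_ _
  exact (withDensity_absolutelyContinuous _ _).ae_le (ae_restrict_mem measurableSet_stdSimplex)

-- A factor `p s` raises one exponent by one, so moments become ratios of normalizing constants.
open Classical in
theorem lintegral_coord_mul_dirichletWeight (hφ : ∀ s, 0 < φ s) (s : S) (F : (S → ℝ) → ENNReal)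
    (hF : Measurable F) :
    ∫⁻ p, ENNReal.ofReal (p s) * F p ∂dirichletWeight φ
      = ∫⁻ p, F p ∂dirichletWeight (φ + Pi.single s 1) := by
  rw [dirichletWeight, dirichletWeight,
    lintegral_withDensity_eq_lintegral_mul _ (measurable_dirichletDensity φ) (by fun_prop),
    lintegral_withDensity_eq_lintegral_mul _ (measurable_dirichletDensity _) hF]
  refine lintegral_congr_ae ((ae_restrict_mem measurableSet_stdSimplex).mono fun p hp => ?_)
  simp only [Pi.mul_apply]
  rw [← mul_assoc, ← ENNReal.ofReal_mul
    (Finset.prod_nonneg fun i _ => Real.rpow_nonneg (hp.1 i) _)]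
  congr 2
  rw [← Finset.mul_prod_erase _ _ (Finset.mem_univ s),
    ← Finset.mul_prod_erase _ _ (Finset.mem_univ s), mul_right_comm]
  congr 1
  -- On the face `p s = 0` both sides are zero because `φ s ≠ 0`.
  · rcases (hp.1 s).eq_or_lt with h | h
    · simp [← h, (hφ s).ne']
    · rw [← Real.rpow_add_one h.ne']
      simp
  · refine Finset.prod_congr rfl fun i hi => ?_
    rw [Pi.add_apply, Pi.single_eq_of_ne (Finset.ne_of_mem_erase hi), add_zero]

-- Apply `Γ (x + 1) = x * Γ x` to one factor of the numerator and to the denominator.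
open Classical in
theorem dirichletWeight_univ_add_single (hφ : ∀ s, 0 < φ s) (s : S) :
    dirichletWeight (φ + Pi.single s 1) Set.univ
      = ENNReal.ofReal (φ s / ∑ i, φ i) * dirichletWeight φ Set.univ := by
  have hΦ : 0 < ∑ i, φ i := Finset.sum_pos (fun s _ => hφ s) Finset.univ_nonempty
  have hφ' : ∀ i, 0 < (φ + Pi.single s 1 : S → ℝ) i := fun i => by
    rw [Pi.add_apply]
    by_cases h : i = s
    · subst h
      simp
      linarith [hφ i]
    · simpa [Pi.single_eq_of_ne h] using hφ i
  have h1 : ∑ i, (φ + Pi.single s 1 : S → ℝ) i = ∑ i, φ i + 1 := by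
    simp [Finset.sum_add_distrib]
  have h2 : ∏ i, Real.Gamma ((φ + Pi.single s 1 : S → ℝ) i) = φ s * ∏ i, Real.Gamma (φ i) := by
    rw [← Finset.mul_prod_erase _ _ (Finset.mem_univ s),
      ← Finset.mul_prod_erase _ (fun i => Real.Gamma (φ i)) (Finset.mem_univ s), ← mul_assoc]
    congr 1
    · simp [Real.Gamma_add_one (hφ s).ne']
    · refine Finset.prod_congr rfl fun i hi => ?_
      rw [Pi.add_apply, Pi.single_eq_of_ne (Finset.ne_of_mem_erase hi), add_zero]
  rw [dirichletWeight_univ hφ, dirichletWeight_univ hφ', h1, h2, Real.Gamma_add_one hΦ.ne',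
    ← ENNReal.ofReal_mul (div_pos (hφ s) hΦ).le]
  congr 1
  ring

open Classical in
theorem lintegral_coord_dirichlet (hφ : ∀ s, 0 < φ s) (s : S) :
    ∫⁻ p, ENNReal.ofReal (p s) ∂dirichlet φ = ENNReal.ofReal (φ s / ∑ i, φ i) := by
  have h := lintegral_coord_mul_dirichletWeight hφ s 1 measurable_const
  have hp := isProbabilityMeasure_dirichlet hφ
  have h1 : (dirichletWeight φ Set.univ)⁻¹ * dirichletWeight φ Set.univ = 1 := hp.measure_univ
  simp only [Pi.one_apply, mul_one, lintegral_one, dirichletWeight_univ_add_single hφ] at h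
  rw [dirichlet, lintegral_smul_measure, h, smul_eq_mul, mul_left_comm, h1, mul_one]

open Classical in
theorem lintegral_coord_sq_dirichlet (hφ : ∀ s, 0 < φ s) (s : S) :
    ∫⁻ p, ENNReal.ofReal (p s) * ENNReal.ofReal (p s) ∂dirichlet φ
      = ENNReal.ofReal ((φ s + 1) / (∑ i, φ i + 1) * (φ s / ∑ i, φ i)) := by
  have hφ' : ∀ i, 0 < (φ + Pi.single s 1 : S → ℝ) i := fun i => by
    rw [Pi.add_apply]
    by_cases h : i = s
    · subst h
      simp
      linarith [hφ i]
    · simpa [Pi.single_eq_of_ne h] using hφ i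
  have hΦ : 0 < ∑ i, φ i := Finset.sum_pos (fun s _ => hφ s) Finset.univ_nonempty
  have h0 := lintegral_coord_mul_dirichletWeight hφ s (fun p => ENNReal.ofReal (p s))
    (by fun_prop)
  have h := lintegral_coord_mul_dirichletWeight hφ' s 1 measurable_const
  have hp := isProbabilityMeasure_dirichlet hφ
  have h1 : (dirichletWeight φ Set.univ)⁻¹ * dirichletWeight φ Set.univ = 1 := hp.measure_univ
  simp only [Pi.one_apply, mul_one, lintegral_one, dirichletWeight_univ_add_single hφ',
    dirichletWeight_univ_add_single hφ] at h
  rw [dirichlet, lintegral_smul_measure, h0, h, smul_eq_mul, mul_left_comm, mul_left_comm _ _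
    (dirichletWeight φ Set.univ), h1, mul_one, ← ENNReal.ofReal_mul]
  · simp [Finset.sum_add_distrib]
  · simp [Finset.sum_add_distrib]
    have := hφ s
    positivity

/-- The centre `c` is arbitrary, so that deviations can be measured from the limit of the means and
not from the means themselves. -/
theorem integral_sq_sub_dirichlet (hφ : ∀ s, 0 < φ s) (s : S) (c : ℝ) :
    Integrable (fun p : S → ℝ => (p s - c) ^ 2) (dirichlet φ) ∧
    ∫ p, (p s - c) ^ 2 ∂dirichlet φ = (φ s + 1) / (∑ i, φ i + 1) * (φ s / ∑ i, φ i)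
      - 2 * c * (φ s / ∑ i, φ i) + c ^ 2 := by
  have hp := isProbabilityMeasure_dirichlet hφ
  have hΦ : 0 < ∑ i, φ i := Finset.sum_pos (fun s _ => hφ s) Finset.univ_nonempty
  have hs := hφ s
  have hmem := ae_dirichlet_mem_stdSimplex φ
  have hle : ∀ p ∈ stdSimplex ℝ S, p s ≤ 1 := fun p hp => by
    rw [← hp.2]
    exact Finset.single_le_sum (fun i _ => hp.1 i) (Finset.mem_univ s)
  have hi1 : Integrable (fun p : S → ℝ => p s) (dirichlet φ) := by
    refine Integrable.of_bound (measurable_pi_apply s).aestronglyMeasurable 1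
      (hmem.mono fun p hp => ?_)
    rw [Real.norm_of_nonneg (hp.1 s)]
    exact hle p hp
  have hi2 : Integrable (fun p : S → ℝ => p s * p s) (dirichlet φ) := by
    refine Integrable.of_bound (by fun_prop) 1
      (hmem.mono fun p hp => ?_)
    rw [Real.norm_of_nonneg (mul_nonneg (hp.1 s) (hp.1 s))]
    exact mul_le_one₀ (hle p hp) (hp.1 s) (hle p hp)
  have e1 : ∫ p, p s ∂dirichlet φ = φ s / ∑ i, φ i := by
    rw [integral_eq_lintegral_of_nonneg_ae (hmem.mono fun p hp => hp.1 s)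
      hi1.aestronglyMeasurable, lintegral_coord_dirichlet hφ, ENNReal.toReal_ofReal]
    positivity
  have e2 : ∫ p, p s * p s ∂dirichlet φ = (φ s + 1) / (∑ i, φ i + 1) * (φ s / ∑ i, φ i) := by
    rw [integral_eq_lintegral_of_nonneg_ae (hmem.mono fun p hp => mul_nonneg (hp.1 s) (hp.1 s))
      hi2.aestronglyMeasurable, lintegral_congr_ae
      (g := fun p => ENNReal.ofReal (p s) * ENNReal.ofReal (p s))
      (hmem.mono fun p hp => ENNReal.ofReal_mul (hp.1 s)),
      lintegral_coord_sq_dirichlet hφ, ENNReal.toReal_ofReal]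
    positivity
  have e3 : (fun p : S → ℝ => (p s - c) ^ 2) = fun p => p s * p s - 2 * c * p s + c ^ 2 := by
    ext p
    ring
  have hi3 : Integrable (fun p : S → ℝ => p s * p s - 2 * c * p s) (dirichlet φ) :=
    hi2.sub (hi1.const_mul _)
  rw [e3]
  refine ⟨hi3.add (integrable_const _), ?_⟩
  rw [integral_add hi3 (integrable_const _), integral_sub hi2 (hi1.const_mul _),
    integral_const_mul, e1, e2]
  simp

/-- Chebyshev's inequality in each coordinate and a union bound. -/
theorem dirichlet_compl_simplexNhd_le (hφ : ∀ s, 0 < φ s) (c : S → ℝ) {ε : ℝ} (hε : 0 < ε) :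
    (dirichlet φ).real (simplexNhd c ε)ᶜ ≤ ∑ s, ((φ s + 1) / (∑ i, φ i + 1) * (φ s / ∑ i, φ i)
      - 2 * c s * (φ s / ∑ i, φ i) + c s ^ 2) / ε ^ 2 := by
  have hp := isProbabilityMeasure_dirichlet hφ
  have h1 : (dirichlet φ).real (simplexNhd c ε)ᶜ
      ≤ (dirichlet φ).real (⋃ s, {p | ε ^ 2 ≤ (p s - c s) ^ 2}) := by
    refine ENNReal.toReal_mono (measure_ne_top _ _) (measure_mono_ae ?_)
    filter_upwards [ae_dirichlet_mem_stdSimplex φ] with p hp hpU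
    have : ∃ s, ε ≤ |p s - c s| := by
      by_contra! h
      exact hpU ⟨hp, h⟩
    obtain ⟨s, hs⟩ := this
    refine Set.mem_iUnion.2 ⟨s, ?_⟩
    change ε ^ 2 ≤ (p s - c s) ^ 2
    rw [← sq_abs (p s - c s)]
    gcongr
  refine h1.trans ((measureReal_iUnion_fintype_le _).trans (Finset.sum_le_sum fun s _ => ?_))
  rw [← (integral_sq_sub_dirichlet hφ s (c s)).2, le_div_iff₀' (by positivity)]
  exact mul_meas_ge_le_integral_of_nonneg (ae_of_all _ fun p => sq_nonneg _)
    (integral_sq_sub_dirichlet hφ s (c s)).1 _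

/-- Dirichlet distributions with large parameters are concentrated near their mean. -/
theorem tendsto_dirichlet_compl_simplexNhd {φ : ℕ → S → ℝ} (hφ : ∀ t s, 0 < φ t s) {c : S → ℝ}
    (hΦ : Tendsto (fun t => ∑ s, φ t s) atTop atTop)
    (hc : ∀ s, Tendsto (fun t => φ t s / ∑ i, φ t i) atTop (𝓝 (c s))) {ε : ℝ} (hε : 0 < ε) :
    Tendsto (fun t => (dirichlet (φ t)).real (simplexNhd c ε)ᶜ) atTop (𝓝 0) := by
  refine squeeze_zero (fun t => measureReal_nonneg)
    (fun t => dirichlet_compl_simplexNhd_le (hφ t) c hε) ?_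
  have hpos : ∀ t, 0 < ∑ s, φ t s := fun t =>
    Finset.sum_pos (fun s _ => hφ t s) Finset.univ_nonempty
  have hinv : Tendsto (fun t => (∑ i, φ t i)⁻¹) atTop (𝓝 0) := tendsto_inv_atTop_zero.comp hΦ
  have h1 : ∀ s, Tendsto (fun t => (φ t s + 1) / (∑ i, φ t i + 1)) atTop (𝓝 (c s)) := fun s => by
    have h := ((hc s).add hinv).div (hinv.const_add 1) (by simp)
    simp only [add_zero, div_one] at h
    refine h.congr fun t => ?_
    have := hpos t
    simp only [Pi.div_apply]
    field_simp
  have h2 : ∀ s, Tendsto (fun t => ((φ t s + 1) / (∑ i, φ t i + 1) * (φ t s / ∑ i, φ t i)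
      - 2 * c s * (φ t s / ∑ i, φ t i) + c s ^ 2) / ε ^ 2) atTop (𝓝 0) := fun s => by
    -- The second moment about `c s` tends to `c s ^ 2 - 2 * c s * c s + c s ^ 2 = 0`.
    have h := (((h1 s).mul (hc s)).sub ((hc s).const_mul (2 * c s))).add_const (c s ^ 2)
    have h' := h.div_const (ε ^ 2)
    convert h' using 2
    ring
  simpa using tendsto_finsetSum _ fun s (_ : s ∈ Finset.univ) => h2 s

end Dirichlet

/-! ### Robustness of the order-statistic estimators -/

section RiskEstimate

theorem sum_Icc_one_eq_sum_range (f : ℕ → ℝ) (k : ℕ) :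
    ∑ j ∈ Finset.Icc 1 k, f j = ∑ i ∈ Finset.range k, f (i + 1) := by
  induction k with
  | zero => simp
  | succ k ih => rw [Finset.sum_Icc_succ_top (by omega), ih, Finset.sum_range_succ]

theorem orderStat_eq {N : ℕ} (X : Fin N → ℝ) {k : ℕ} (h : k - 1 < N) :
    orderStat X k = X (Tuple.sort X ⟨k - 1, h⟩) := dif_pos h

variable {N k : ℕ} {X Y : Fin N → ℝ} {x D : ℝ}

/-- All `N - k + 1` samples of rank at least `k` exceed `x + D` by at least as much as the order
statistic does, and each pays for this with its own `Y`. -/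
theorem mul_orderStat_sub_le (hk₁ : 1 ≤ k) (hkN : k ≤ N) (hY : ∀ i, 0 ≤ Y i)
    (h : ∀ i, |X i - x| ≤ D + Y i) :
    ((N : ℝ) - k + 1) * (orderStat X k - x - D) ≤ ∑ i, Y i := by
  have hk : k - 1 < N := by omega
  rw [orderStat_eq X hk, ← Equiv.sum_comp (Tuple.sort X) Y]
  have h1 : ∀ i ∈ Finset.Ici (⟨k - 1, hk⟩ : Fin N),
      X (Tuple.sort X ⟨k - 1, hk⟩) - x - D ≤ Y (Tuple.sort X i) := fun i hi => by
    have h2 : X (Tuple.sort X ⟨k - 1, hk⟩) ≤ X (Tuple.sort X i) :=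
      Tuple.monotone_sort X (Finset.mem_Ici.1 hi)
    have h3 := (le_abs_self _).trans (h (Tuple.sort X i))
    linarith
  have h4 := Finset.card_nsmul_le_sum _ _ _ h1
  rw [Fin.card_Ici, nsmul_eq_mul] at h4
  have h5 : ((N - (k - 1) : ℕ) : ℝ) = (N : ℝ) - k + 1 := by
    rw [Nat.cast_sub hk.le, Nat.cast_sub hk₁]
    push_cast
    ring
  simp only [h5] at h4
  exact h4.trans (Finset.sum_le_sum_of_subset_of_nonneg (Finset.subset_univ _)
    fun i _ _ => hY _)

/-- The mirror image: here the `k` samples of rank at most `k` pay. -/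
theorem mul_sub_orderStat_le (hk₁ : 1 ≤ k) (hkN : k ≤ N) (hY : ∀ i, 0 ≤ Y i)
    (h : ∀ i, |X i - x| ≤ D + Y i) :
    (k : ℝ) * (x - orderStat X k - D) ≤ ∑ i, Y i := by
  have hk : k - 1 < N := by omega
  rw [orderStat_eq X hk, ← Equiv.sum_comp (Tuple.sort X) Y]
  have h1 : ∀ i ∈ Finset.Iic (⟨k - 1, hk⟩ : Fin N),
      x - X (Tuple.sort X ⟨k - 1, hk⟩) - D ≤ Y (Tuple.sort X i) := fun i hi => by
    have h2 : X (Tuple.sort X i) ≤ X (Tuple.sort X ⟨k - 1, hk⟩) :=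
      Tuple.monotone_sort X (Finset.mem_Iic.1 hi)
    have h3 := (neg_abs_le _).trans' (neg_le_neg (h (Tuple.sort X i)))
    linarith
  have h4 := Finset.card_nsmul_le_sum _ _ _ h1
  rw [Fin.card_Iic, nsmul_eq_mul] at h4
  have h5 : ((k - 1 + 1 : ℕ) : ℝ) = k := by rw [Nat.sub_add_cancel hk₁]
  simp only [h5] at h4
  exact h4.trans (Finset.sum_le_sum_of_subset_of_nonneg (Finset.subset_univ _)
    fun i _ _ => hY _)

theorem abs_sum_orderStat_sub_le (hkN : k ≤ N) (hY : ∀ i, 0 ≤ Y i)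
    (h : ∀ i, |X i - x| ≤ D + Y i) :
    |∑ j ∈ Finset.Icc 1 k, orderStat X j - k * x| ≤ k * D + ∑ i, Y i := by
  set F : ℕ → ℝ := fun i => if hi : i < N then Y (Tuple.sort X ⟨i, hi⟩) else 0 with hF
  have hF0 : ∀ i, 0 ≤ F i := fun i => by
    simp only [hF]
    split_ifs
    · exact hY _
    · exact le_rfl
  have h1 : ∑ i ∈ Finset.range N, F i = ∑ i, Y i := by
    rw [← Equiv.sum_comp (Tuple.sort X) Y, Finset.sum_range]
    simp [hF]
  have h2 : ∑ j ∈ Finset.Icc 1 k, orderStat X j - k * x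
      = ∑ i ∈ Finset.range k, (orderStat X (i + 1) - x) := by
    rw [sum_Icc_one_eq_sum_range, Finset.sum_sub_distrib]
    simp
  rw [h2]
  calc |∑ i ∈ Finset.range k, (orderStat X (i + 1) - x)|
      ≤ ∑ i ∈ Finset.range k, (D + F i) := by
        refine (Finset.abs_sum_le_sum_abs _ _).trans (Finset.sum_le_sum fun i hi => ?_)
        have hi' : i < N := (Finset.mem_range.1 hi).trans_le hkN
        rw [orderStat_eq X (k := i + 1) hi']
        simpa [hF, hi'] using h (Tuple.sort X ⟨i, hi'⟩)
    _ = k * D + ∑ i ∈ Finset.range k, F i := by simp [Finset.sum_add_distrib]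
    _ ≤ k * D + ∑ i, Y i := by
        rw [← h1]
        gcongr
        exact fun i _ _ => hF0 i

/-- If most sample points are close to `x`, then so is the risk estimate. -/
theorem abs_riskEstimate_sub_le (ρ : Risk) {α : ℝ} (hα₀ : 0 < α) (hα₁ : α < 1) (hN : 1 ≤ N)
    (hY : ∀ i, 0 ≤ Y i) (h : ∀ i, |X i - x| ≤ D + Y i) :
    |riskEstimate ρ α X - x| ≤ D + (min α (1 - α))⁻¹ * ((∑ i, Y i) / N) := by
  have hN0 : (0 : ℝ) < N := by exact_mod_cast hN
  have hsum : 0 ≤ ∑ i, Y i := Finset.sum_nonneg fun i _ => hY i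
  have hc : 0 < min α (1 - α) := lt_min hα₀ (by linarith)
  set k := ⌈(N : ℝ) * α⌉₊ with hk
  have hk₁ : 1 ≤ k := Nat.one_le_ceil_iff.2 (by positivity)
  have hkN : k ≤ N := Nat.ceil_le.2 (by nlinarith)
  have hkα : (N : ℝ) * α ≤ k := Nat.le_ceil _
  have hkα' : (k : ℝ) < N * α + 1 := Nat.ceil_lt_add_one (by positivity)
  have hk0 : (0 : ℝ) < k := by exact_mod_cast hk₁
  -- Here `b` is the number of samples that pay; if `y ≤ D` there is nothing to pay for.
  have key : ∀ b : ℝ, ∀ y : ℝ, N * min α (1 - α) ≤ b → b * (y - D) ≤ ∑ i, Y i →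
      y ≤ D + (min α (1 - α))⁻¹ * ((∑ i, Y i) / N) := by
    intro b y hb hy
    have h1 : 0 < N * min α (1 - α) := by positivity
    have e : (min α (1 - α))⁻¹ * ((∑ i, Y i) / N) = (∑ i, Y i) / (N * min α (1 - α)) := by
      field_simp
    rw [e, ← sub_le_iff_le_add', le_div_iff₀' h1]
    rcases le_total 0 (y - D) with h0 | h0
    · exact (mul_le_mul_of_nonneg_right hb h0).trans hy
    · exact (mul_nonpos_of_nonneg_of_nonpos h1.le h0).trans hsum
  have hbk : N * min α (1 - α) ≤ k :=
    (mul_le_mul_of_nonneg_left (min_le_left _ _) hN0.le).trans hkα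
  -- The ceiling satisfies `k < N * α + 1`, so at least `N * (1 - α)` samples have rank `k` or more.
  have hbk' : N * min α (1 - α) ≤ (N : ℝ) - k + 1 := by
    have := mul_le_mul_of_nonneg_left (min_le_right α (1 - α)) hN0.le
    linarith
  cases ρ with
  | var =>
    simp only [riskEstimate]
    rw [abs_le']
    exact ⟨key _ _ hbk' (mul_orderStat_sub_le hk₁ hkN hY h),
      key _ _ hbk (by simpa using mul_sub_orderStat_le hk₁ hkN hY h)⟩
  | cvar =>
    simp only [riskEstimate]
    refine key _ _ hbk ?_
    rw [mul_sub, ← hk, ← abs_of_pos hk0, ← abs_mul, abs_of_pos hk0, mul_sub,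
      mul_div_cancel₀ _ hk0.ne', sub_le_iff_le_add']
    exact abs_sum_orderStat_sub_le hkN hY h

end RiskEstimate

/-! ### Consistency of the posterior means -/

section Posterior

variable {S A : Type*}

open Classical in
/-- The Dirichlet parameter of `(s, a, x)` after `m` observations. -/
def posterior (φ₀ : S → A → S → ℝ) (w : ℕ → S × A × S) (m : ℕ) (s : S) (a : A) (x : S) : ℝ :=
  φ₀ s a x + ∑ j ∈ Finset.range m, if w j = (s, a, x) then 1 else 0

open Classical in
theorem posterior_succ (φ₀ : S → A → S → ℝ) (w : ℕ → S × A × S) (m : ℕ) (s : S) (a : A) (x : S) :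
    posterior φ₀ w (m + 1) s a x = posterior φ₀ w m s a x + if w m = (s, a, x) then 1 else 0 := by
  rw [posterior, Finset.sum_range_succ, ← add_assoc]
  rfl

theorem posterior_pos {φ₀ : S → A → S → ℝ} (h : ∀ s a x, 0 < φ₀ s a x) (w : ℕ → S × A × S)
    (m : ℕ) (s : S) (a : A) (x : S) : 0 < posterior φ₀ w m s a x := by
  classical
  exact add_pos_of_pos_of_nonneg (h s a x) (Finset.sum_nonneg fun j _ => by split_ifs <;> simp)

variable [Fintype S]

open Classical in
/-- The step size of the recursion for the posterior mean of the transition law of `(s, a)`. -/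
def posteriorRate (φ₀ : S → A → S → ℝ) (w : ℕ → S × A × S) (s : S) (a : A) (m : ℕ) : ℝ :=
  if ((w m).1, (w m).2.1) = (s, a) then (∑ x, posterior φ₀ w m s a x + 1)⁻¹ else 0

open Classical in
theorem sum_posterior_succ (φ₀ : S → A → S → ℝ) (w : ℕ → S × A × S) (m : ℕ) (s : S) (a : A) :
    ∑ x, posterior φ₀ w (m + 1) s a x = ∑ x, posterior φ₀ w m s a x +
      if ((w m).1, (w m).2.1) = (s, a) then 1 else 0 := by
  simp_rw [posterior_succ, Finset.sum_add_distrib]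
  congr 1
  split_ifs with h
  · simp only [Prod.mk.injEq] at h
    rw [Finset.sum_eq_single (w m).2.2]
    · simp [Prod.ext_iff, h]
    · intro x _ hx
      simp [Prod.ext_iff, hx.symm]
    · simp
  · refine Finset.sum_eq_zero fun x _ => if_neg fun h' => h ?_
    rw [h']

variable [Nonempty S] {φ₀ : S → A → S → ℝ}

theorem sum_posterior_pos (hφ : ∀ s a x, 0 < φ₀ s a x) (w : ℕ → S × A × S) (m : ℕ) (s : S) (a : A) :
    0 < ∑ x, posterior φ₀ w m s a x :=
  Finset.sum_pos (fun x _ => posterior_pos hφ w m s a x) Finset.univ_nonempty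

-- The posterior mean is a stochastic approximation driven by the indicator of the observed
-- successor; it stands still when another pair is visited.
open Classical in
theorem posteriorMean_succ (hφ : ∀ s a x, 0 < φ₀ s a x) (w : ℕ → S × A × S) (m : ℕ) (s : S) (a : A)
    (x : S) (c : ℝ) :
    posterior φ₀ w (m + 1) s a x / ∑ y, posterior φ₀ w (m + 1) s a y - c
      = (1 - posteriorRate φ₀ w s a m) *
          (posterior φ₀ w m s a x / ∑ y, posterior φ₀ w m s a y - c)
        + posteriorRate φ₀ w s a m * ((if (w m).2.2 = x then 1 else 0) - c) := by
  have h := sum_posterior_pos hφ w m s a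
  rw [sum_posterior_succ, posterior_succ, posteriorRate]
  by_cases hv : ((w m).1, (w m).2.1) = (s, a)
  · have e : (w m = (s, a, x)) ↔ (w m).2.2 = x := by
      simp only [Prod.mk.injEq] at hv
      simp [Prod.ext_iff, hv]
    simp only [if_pos hv, e]
    field_simp
    ring
  · have e : ¬ w m = (s, a, x) := fun h' => hv (by rw [h'])
    simp only [if_neg hv, if_neg e]
    ring

theorem posteriorRate_nonneg (hφ : ∀ s a x, 0 < φ₀ s a x) (w : ℕ → S × A × S) (s : S) (a : A)
    (m : ℕ) : 0 ≤ posteriorRate φ₀ w s a m := by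
  have h := sum_posterior_pos hφ w m s a
  unfold posteriorRate
  split_ifs
  · positivity
  · exact le_rfl

theorem posteriorRate_le_one (hφ : ∀ s a x, 0 < φ₀ s a x) (w : ℕ → S × A × S) (s : S) (a : A)
    (m : ℕ) : posteriorRate φ₀ w s a m ≤ 1 := by
  have h := sum_posterior_pos hφ w m s a
  unfold posteriorRate
  split_ifs
  · exact inv_le_one_of_one_le₀ (by linarith)
  · exact zero_le_one

/-- Telescoping: `(Φ + 1)⁻¹ ^ 2 ≤ Φ⁻¹ - (Φ + 1)⁻¹` at each visit. The bound is the same for all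
realizations. -/
theorem sum_posteriorRate_sq_le (hφ : ∀ s a x, 0 < φ₀ s a x) (w : ℕ → S × A × S) (s : S) (a : A)
    (n : ℕ) : ∑ m ∈ Finset.range n, posteriorRate φ₀ w s a m ^ 2 ≤ (∑ x, φ₀ s a x)⁻¹ := by
  have key : ∑ m ∈ Finset.range n, posteriorRate φ₀ w s a m ^ 2 ≤
      (∑ x, φ₀ s a x)⁻¹ - (∑ x, posterior φ₀ w n s a x)⁻¹ := by
    induction n with
    | zero => simp [posterior]
    | succ n ih =>
      rw [Finset.sum_range_succ]
      suffices posteriorRate φ₀ w s a n ^ 2 ≤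
          (∑ x, posterior φ₀ w n s a x)⁻¹ - (∑ x, posterior φ₀ w (n + 1) s a x)⁻¹ by linarith
      have h := sum_posterior_pos hφ w n s a
      rw [sum_posterior_succ, posteriorRate]
      set Φ := ∑ x, posterior φ₀ w n s a x
      split_ifs
      · have e : Φ⁻¹ - (Φ + 1)⁻¹ = (Φ + 1)⁻¹ * Φ⁻¹ := by
          field_simp
          ring
        rw [e, sq]
        gcongr
        linarith
      · simp
  have h := sum_posterior_pos hφ w n s a
  exact key.trans (sub_le_self _ (by positivity))

/-- At a visit `log ((Φ + 2) / (Φ + 1)) ≤ 1 / (Φ + 1)`, so the rates have a divergent sum as soon as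
`Φ → ∞`. -/
theorem log_sub_log_le_sum_posteriorRate (hφ : ∀ s a x, 0 < φ₀ s a x) (w : ℕ → S × A × S) (s : S)
    (a : A) (n : ℕ) : Real.log (∑ x, posterior φ₀ w n s a x + 1) -
      Real.log (∑ x, posterior φ₀ w 0 s a x + 1) ≤
        ∑ m ∈ Finset.range n, posteriorRate φ₀ w s a m := by
  induction n with
  | zero => simp
  | succ n ih =>
    rw [Finset.sum_range_succ]
    suffices Real.log (∑ x, posterior φ₀ w (n + 1) s a x + 1) -
        Real.log (∑ x, posterior φ₀ w n s a x + 1) ≤ posteriorRate φ₀ w s a n by linarith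
    have h := sum_posterior_pos hφ w n s a
    rw [sum_posterior_succ, posteriorRate]
    set Φ := ∑ x, posterior φ₀ w n s a x
    split_ifs
    · rw [← Real.log_div (by positivity) (by positivity)]
      refine (Real.log_le_sub_one_of_pos (by positivity)).trans (le_of_eq ?_)
      field_simp
      ring
    · simp

variable {Ω : Type*} {m0 : MeasurableSpace Ω} {μ : Measure Ω} [IsProbabilityMeasure μ]

omit [Fintype S] [Nonempty S] in
theorem measurable_posterior {m : MeasurableSpace Ω} {w : ℕ → Ω → S × A × S} {n : ℕ}
    (hw : ∀ j < n, Measurable[m, ⊤] (w j)) (s : S) (a : A) (x : S) :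
    Measurable[m] fun ω => posterior φ₀ (fun j => w j ω) n s a x := by
  classical
  refine measurable_const.add (Finset.measurable_fun_sum _ fun j hj => ?_)
  exact (measurable_from_top : Measurable[⊤]
    fun o : S × A × S => if o = (s, a, x) then (1 : ℝ) else 0).comp (hw j (Finset.mem_range.1 hj))

/-- The posterior means are consistent. -/
theorem ae_tendsto_posteriorMean (hφ : ∀ s a x, 0 < φ₀ s a x) (ℱ : Filtration ℕ m0)
    {w : ℕ → Ω → S × A × S} {pc : S → A → S → ℝ} (hpc : ∀ s a, pc s a ∈ stdSimplex ℝ S)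
    (hw : ∀ m, Measurable[ℱ (m + 1), ⊤] (w m))
    (hw' : ∀ m, Measurable[ℱ m, ⊤] fun ω => ((w m ω).1, (w m ω).2.1))
    (hlaw : ∀ m x, μ⟦{ω | (w m ω).2.2 = x} | ℱ m⟧ =ᵐ[μ] fun ω => pc (w m ω).1 (w m ω).2.1 x)
    (s : S) (a : A) (x : S) :
    ∀ᵐ ω ∂μ, Tendsto (fun m => ∑ y, posterior φ₀ (fun j => w j ω) m s a y) atTop atTop →
      Tendsto (fun m => posterior φ₀ (fun j => w j ω) m s a x /
        ∑ y, posterior φ₀ (fun j => w j ω) m s a y) atTop (𝓝 (pc s a x)) := by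
  classical
  set r : ℕ → Ω → ℝ := fun m ω => posteriorRate φ₀ (fun j => w j ω) s a m with hr
  set I : ℕ → Ω → ℝ := fun m => {ω | (w m ω).2.2 = x}.indicator fun _ => (1 : ℝ) with hI
  set ξ : ℕ → Ω → ℝ := fun m ω => r m ω * (I m ω - pc s a x) with hξ
  have hp0 : 0 ≤ pc s a x := (hpc s a).1 x
  have hp1 : pc s a x ≤ 1 := by
    rw [← (hpc s a).2]
    exact Finset.single_le_sum (fun i _ => (hpc s a).1 i) (Finset.mem_univ x)
  have hwj : ∀ m, ∀ j < m, Measurable[ℱ m, ⊤] (w j) := fun m j hj =>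
    (hw j).mono (ℱ.mono hj) le_rfl
  -- The rate depends on the pair visited now, which is why `ℱ m` has to contain the current state
  -- and action.
  have hrm : ∀ m, Measurable[ℱ m] (r m) := fun m => by
    refine Measurable.ite (hw' m (MeasurableSpace.measurableSet_top (s := {(s, a)}))) ?_
      measurable_const
    exact ((Finset.measurable_fun_sum _ fun y _ =>
      measurable_posterior (hwj m) s a y).add measurable_const).inv
  have hIset : ∀ m, MeasurableSet[ℱ (m + 1)] {ω | (w m ω).2.2 = x} := fun m =>
    hw m (MeasurableSpace.measurableSet_top (s := {o : S × A × S | o.2.2 = x}))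
  have hIm : ∀ m, Measurable[ℱ (m + 1)] (I m) := fun m =>
    (@measurable_const _ _ _ (ℱ (m + 1)) _).indicator (hIset m)
  have hI1 : ∀ m ω, |I m ω - pc s a x| ≤ 1 := fun m ω => by
    simp only [hI, Set.indicator]
    rw [abs_le]
    split_ifs <;> constructor <;> linarith
  have hξm : ∀ m, StronglyMeasurable[ℱ (m + 1)] (ξ m) := fun m =>
    (((hrm m).mono (ℱ.mono (Nat.le_succ m)) le_rfl).mul
      ((hIm m).sub_const _)).stronglyMeasurable
  have hr0 : ∀ m ω, 0 ≤ r m ω := fun m ω => posteriorRate_nonneg hφ _ s a m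
  have hr1 : ∀ m ω, r m ω ≤ 1 := fun m ω => posteriorRate_le_one hφ _ s a m
  have hξr : ∀ m ω, |ξ m ω| ≤ r m ω := fun m ω => by
    rw [hξ, abs_mul, abs_of_nonneg (hr0 m ω)]
    exact mul_le_of_le_one_right (hr0 m ω) (hI1 m ω)
  have hIint : ∀ m, Integrable (I m) μ := fun m =>
    (integrable_const (1 : ℝ)).indicator (ℱ.le _ _ (hIset m))
  have hξ0 : ∀ m, μ[ξ m | ℱ m] =ᵐ[μ] 0 := fun m => by
    have hint : Integrable (I m - fun _ => pc s a x) μ := (hIint m).sub (integrable_const _)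
    have h1 := condExp_stronglyMeasurable_mul_of_bound (ℱ.le m) (hrm m).stronglyMeasurable hint 1
      (ae_of_all _ fun ω => by
        rw [Real.norm_of_nonneg (hr0 m ω)]
        exact hr1 m ω)
    have h2 := condExp_sub (μ := μ) (hIint m) (integrable_const (pc s a x)) (ℱ m)
    rw [condExp_const (ℱ.le m)] at h2
    filter_upwards [h1, h2, hlaw m x] with ω h1 h2 h3
    change μ[r m * (I m - fun _ => pc s a x) | ℱ m] ω = 0
    rw [h1, Pi.mul_apply, h2, Pi.sub_apply]
    change r m ω * (μ[I m | ℱ m] ω - pc s a x) = 0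
    rw [h3]
    -- Away from `(s, a)` the rate is zero; at `(s, a)` the conditional law is exactly `pc s a`.
    simp only [hr, posteriorRate]
    split_ifs with hv
    · simp only [Prod.mk.injEq] at hv
      rw [hv.1, hv.2, sub_self, mul_zero]
    · rw [zero_mul]
  have hconv := ae_tendsto_sum_of_condExp_eq_zero (μ := μ) ℱ hξm
    (c := fun _ => 1) (fun m ω => (hξr m ω).trans (hr1 m ω)) hξ0 (R := (∑ x, φ₀ s a x)⁻¹)
    (fun n ω => by
      refine (Finset.sum_le_sum fun m _ => ?_).trans
        (sum_posteriorRate_sq_le hφ (fun j => w j ω) s a n)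
      rw [← sq_abs]
      exact pow_le_pow_left₀ (abs_nonneg _) (hξr m ω) 2)
  filter_upwards [hconv] with ω hω hΦ
  obtain ⟨l, hl⟩ := hω
  have hsum : Tendsto (fun n => ∑ m ∈ Finset.range n, r m ω) atTop atTop := by
    refine tendsto_atTop_mono (log_sub_log_le_sum_posteriorRate hφ (fun j => w j ω) s a) ?_
    exact tendsto_atTop_add_const_right _ _
      (Real.tendsto_log_atTop.comp (tendsto_atTop_add_const_right _ _ hΦ))
  -- The centred mean is driven by noise alone, hence `g = 0`.
  have h := tendsto_of_averaging_add (w := fun m => posterior φ₀ (fun j => w j ω) m s a x /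
        ∑ y, posterior φ₀ (fun j => w j ω) m s a y - pc s a x) (a := fun m => r m ω)
      (g := fun _ => 0) (fun m => hr0 m ω) (fun m => hr1 m ω) hsum tendsto_const_nhds hl
      (fun m => by
        rw [posteriorMean_succ hφ]
        simp [hξ, hr, hI, Set.indicator])
  simpa using h.add_const (pc s a x)

end Posterior

/-! ### The observation stream as one sequence, and its filtration -/

section Stream

/-- The terms of a sequence of finite blocks, block `t` having length `c t`, one after another. -/
def flatten {β : Type*} (c : ℕ → ℕ) (z : ℕ → ℕ → β) (m : ℕ) : β :=
  z (blockOf c m) (m - ∑ τ ∈ Finset.range (blockOf c m), c τ)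

theorem flatten_add {β : Type*} {c : ℕ → ℕ} (z : ℕ → ℕ → β) {t l : ℕ} (hl : l < c t) :
    flatten c z (∑ τ ∈ Finset.range t, c τ + l) = z t l := by
  rw [flatten, blockOf_add hl, Nat.add_sub_cancel_left]

theorem sum_range_flatten {c : ℕ → ℕ} (f : ℕ → ℕ → ℝ) (T : ℕ) :
    ∑ t ∈ Finset.range T, ∑ i ∈ Finset.range (c t), f t i
      = ∑ m ∈ Finset.range (∑ τ ∈ Finset.range T, c τ), flatten c f m := by
  induction T with
  | zero => simp
  | succ T ih =>
    rw [Finset.sum_range_succ, Finset.sum_range_succ, Finset.sum_range_add, ih]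
    congr 1
    exact Finset.sum_congr rfl fun i hi => (flatten_add f (Finset.mem_range.1 hi)).symm

variable {S A : Type*} (C : Input S A)

/-- The model after `m` observations. -/
def flatModel (w : ℕ → S × A × S) : ℕ → Model S A
  | 0 => initialModel C
  | m + 1 => observe C (flatModel w m) (w m)

theorem model_eq_flatModel (z : ℕ → ℕ → S × A × S) (t : ℕ) :
    model C z t = flatModel C (flatten C.batchSize z)
      (∑ τ ∈ Finset.range t, C.batchSize τ) :=
  eq_of_foldl_blocks (F := fun t i M => observe C M (z t i)) (x := model C z)
    (y := flatModel C (flatten C.batchSize z)) rfl (fun t => rfl)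
    (fun t l hl => by rw [flatModel, flatten_add _ hl]) t

theorem flatModel_param (w : ℕ → S × A × S) (m : ℕ) :
    (flatModel C w m).param = posterior C.prior w m := by
  classical
  induction m with
  | zero =>
    ext s a x
    simp [flatModel, initialModel, posterior]
  | succ m ih =>
    ext s a x
    rw [posterior_succ, ← ih]
    rfl

theorem model_param (z : ℕ → ℕ → S × A × S) (t : ℕ) :
    (model C z t).param = posterior C.prior (flatten C.batchSize z)
      (∑ τ ∈ Finset.range t, C.batchSize τ) := by
  rw [model_eq_flatModel, flatModel_param]

theorem flatModel_size (w : ℕ → S × A × S) (m : ℕ) (s : S) (a : A) :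
    C.minSize ≤ (flatModel C w m).size s a ∧ (flatModel C w m).size s a ≤ C.minSize + m := by
  induction m with
  | zero => simp [flatModel, initialModel]
  | succ m ih =>
    simp only [flatModel, observe]
    split_ifs <;> omega

theorem minSize_le_model_size (z : ℕ → ℕ → S × A × S) (t : ℕ) (s : S) (a : A) :
    C.minSize ≤ (model C z t).size s a := by
  rw [model_eq_flatModel]
  exact (flatModel_size C _ _ s a).1

theorem model_size_le (z : ℕ → ℕ → S × A × S) (t : ℕ) (s : S) (a : A) :
    (model C z t).size s a ≤ C.minSize + ∑ τ ∈ Finset.range t, C.batchSize τ := by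
  rw [model_eq_flatModel]
  exact (flatModel_size C _ _ s a).2

variable {Ω : Type*} [Finite S] [Finite A]

/-- With finitely many possible transitions, a preimage is a finite union over the latest one. This
is why the discrete σ-algebra on models does no harm. -/
theorem measurable_flatModel {m : MeasurableSpace Ω} {w : ℕ → Ω → S × A × S} {n : ℕ}
    (hw : ∀ j < n, Measurable[m, ⊤] (w j)) :
    Measurable[m, ⊤] fun ω => flatModel C (fun j => w j ω) n := by
  induction n with
  | zero => exact @measurable_const _ _ ⊤ m _
  | succ n ih =>
    intro B _
    have e : (fun ω => flatModel C (fun j => w j ω) (n + 1)) ⁻¹' B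
        = ⋃ o : S × A × S, w n ⁻¹' {o} ∩
          (fun ω => flatModel C (fun j => w j ω) n) ⁻¹' {M | observe C M o ∈ B} := by
      ext ω
      simp [flatModel]
    rw [e]
    exact MeasurableSet.iUnion fun o =>
      (hw n (Nat.lt_succ_self n) MeasurableSpace.measurableSet_top).inter
        (ih (fun j hj => hw j (hj.trans (Nat.lt_succ_self n))) MeasurableSpace.measurableSet_top)

variable {C}

-- Only entries inside a batch are known to be measurable; by `hc` every flat index is such an
-- entry.
omit [Finite S] [Finite A] in
theorem measurable_flatten {m : MeasurableSpace Ω} {Z : ℕ → ℕ → Ω → S × A × S}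
    (hc : Tendsto (fun t => ∑ τ ∈ Finset.range t, C.batchSize τ) atTop atTop)
    (hZ : ∀ t i, i < C.batchSize t → Measurable[m, ⊤] (Z t i)) (j : ℕ) :
    Measurable[m, ⊤] (flatten C.batchSize Z j) := by
  obtain ⟨l, hl, h⟩ := exists_eq_block_add hc j
  rw [flatten]
  exact hZ _ _ (by omega)

theorem measurable_model {m : MeasurableSpace Ω} {Z : ℕ → ℕ → Ω → S × A × S}
    (hc : Tendsto (fun t => ∑ τ ∈ Finset.range t, C.batchSize τ) atTop atTop)
    (hZ : ∀ t i, i < C.batchSize t → Measurable[m, ⊤] (Z t i)) (t : ℕ) :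
    Measurable[m, ⊤] fun ω => model C (fun t i => Z t i ω) t := by
  simp_rw [model_eq_flatModel]
  exact measurable_flatModel C fun j _ => measurable_flatten hc hZ j

variable [MeasurableSpace Ω] {μ : Measure Ω} {pc : S → A → S → ℝ} {Z : ℕ → ℕ → Ω → S × A × S}

theorem IsObservationStream.measurable (hZ : IsObservationStream μ C pc Z) {t i : ℕ}
    (hi : i < C.batchSize t) : Measurable[_, ⊤] (Z t i) := by
  intro B _
  have e : Z t i ⁻¹' B = ⋃ o ∈ B, {ω | Z t i ω = o} := by
    ext ω
    simp
  rw [e]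
  exact MeasurableSet.biUnion B.to_countable fun o _ => hZ.measurableSet t i hi o

omit [Finite S] [Finite A] [MeasurableSpace Ω] in
theorem measurable_pastObservations {t i t' i' : ℕ} (hi' : i' < C.batchSize t')
    (h : t' < t ∨ (t' = t ∧ i' < i)) :
    Measurable[pastObservations C Z t i, ⊤] (Z t' i') := by
  refine (comap_measurable (Z t' i')).mono (le_sup_of_le_left ?_) le_rfl
  exact le_iSup_of_le t' (le_iSup_of_le i' (le_iSup_of_le ⟨hi', h⟩ le_rfl))

theorem pastObservations_le (hZ : IsObservationStream μ C pc Z) {t i : ℕ}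
    (hi : i < C.batchSize t) : pastObservations C Z t i ≤ ‹MeasurableSpace Ω› := by
  refine sup_le (iSup_le fun t' => iSup_le fun i' => iSup_le fun h =>
    (hZ.measurable h.1).comap_le) ?_
  refine Measurable.comap_le ?_
  exact (show Measurable[⊤, ⊤] fun o : S × A × S => (o.1, o.2.1) from
    fun _ _ => MeasurableSpace.measurableSet_top).comp (hZ.measurable hi)

omit [Finite S] [Finite A] [MeasurableSpace Ω] in
theorem pastObservations_mono {t i t' i' : ℕ} (hi' : i' < C.batchSize t')
    (h : t' < t ∨ (t' = t ∧ i' < i)) : pastObservations C Z t' i' ≤ pastObservations C Z t i := by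
  refine sup_le (iSup_le fun t'' => iSup_le fun i'' => iSup_le fun h' =>
    (measurable_pastObservations h'.1 (by omega)).comap_le) ?_
  refine Measurable.comap_le ?_
  exact (show Measurable[⊤, ⊤] fun o : S × A × S => (o.1, o.2.1) from
    fun _ _ => MeasurableSpace.measurableSet_top).comp
    (measurable_pastObservations hi' h)

/-- The order of flat indices is the lexicographic order of stage and position, as in
`pastObservations`. -/
theorem blockOf_lt_or {c : ℕ → ℕ}
    (hc : Tendsto (fun t => ∑ τ ∈ Finset.range t, c τ) atTop atTop) {m m' : ℕ} (h : m < m') :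
    blockOf c m < blockOf c m' ∨ (blockOf c m = blockOf c m' ∧
      m - ∑ τ ∈ Finset.range (blockOf c m), c τ < m' - ∑ τ ∈ Finset.range (blockOf c m'), c τ) := by
  obtain ⟨l, hl, e⟩ := exists_eq_block_add hc m
  obtain ⟨l', hl', e'⟩ := exists_eq_block_add hc m'
  rcases lt_trichotomy (blockOf c m) (blockOf c m') with h1 | h1 | h1
  · exact Or.inl h1
  · rw [← h1] at e' ⊢
    omega
  · have : ∑ τ ∈ Finset.range (blockOf c m' + 1), c τ ≤ ∑ τ ∈ Finset.range (blockOf c m), c τ :=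
      Finset.sum_le_sum_of_subset (Finset.range_subset_range.2 h1)
    rw [Finset.sum_range_succ] at this
    omega

/-- The information that precedes each observation, including its own state and action. -/
def observationFiltration (hZ : IsObservationStream μ C pc Z)
    (hc : Tendsto (fun t => ∑ τ ∈ Finset.range t, C.batchSize τ) atTop atTop) :
    Filtration ℕ ‹MeasurableSpace Ω› where
  seq m := pastObservations C Z (blockOf C.batchSize m)
    (m - ∑ τ ∈ Finset.range (blockOf C.batchSize m), C.batchSize τ)
  mono' := monotone_nat_of_le_succ fun m => by
    obtain ⟨l, hl, e⟩ := exists_eq_block_add hc m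
    exact pastObservations_mono (by omega) (blockOf_lt_or hc (Nat.lt_succ_self m))
  le' m := by
    obtain ⟨l, hl, e⟩ := exists_eq_block_add hc m
    exact pastObservations_le hZ (by omega)

omit [Finite S] [Finite A] in
theorem tendsto_sum_batchSize {z : ℕ → ℕ → S × A × S} {s : S} {a : A} {x : S}
    (h : totalCount C z s a x = ⊤) :
    Tendsto (fun t => ∑ τ ∈ Finset.range t, C.batchSize τ) atTop atTop := by
  refine tendsto_atTop_atTop_of_monotone
    (fun t t' h => Finset.sum_le_sum_of_subset (Finset.range_subset_range.2 h)) fun b => ?_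
  by_contra! hb
  refine (ENNReal.natCast_ne_top b) (top_le_iff.1 ?_)
  rw [← h]
  refine ENNReal.tsum_le_of_sum_range_le fun T => ?_
  calc _ ≤ ∑ t ∈ Finset.range T, ∑ i ∈ Finset.range (C.batchSize t), (1 : ENNReal) :=
        Finset.sum_le_sum fun t _ => Finset.sum_le_sum fun i _ => by split_ifs <;> simp
    _ = ((∑ t ∈ Finset.range T, C.batchSize t : ℕ) : ENNReal) := by simp
    _ ≤ b := by exact_mod_cast (hb T).le

end Stream

/-! ### Concentration of the posterior at the true law -/

section Consistency

variable {S A Ω : Type*} [Fintype S] {C : Input S A}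

theorem tendsto_sum_posterior (hprior : ∀ s a s', 0 < C.prior s a s') {z : ℕ → ℕ → S × A × S}
    {s : S} {a : A} {x : S} (h : totalCount C z s a x = ⊤) :
    Tendsto (fun m => ∑ y, posterior C.prior (flatten C.batchSize z) m s a y) atTop atTop := by
  classical
  set w := flatten C.batchSize z with hw
  refine tendsto_atTop_atTop_of_monotone (monotone_nat_of_le_succ fun m => ?_) fun b => ?_
  · rw [sum_posterior_succ]
    split_ifs <;> simp
  by_contra! hb
  refine (ENNReal.ofReal_ne_top (r := b)) (top_le_iff.1 ?_)
  rw [← h]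
  refine ENNReal.tsum_le_of_sum_range_le fun T => ?_
  set n := ∑ τ ∈ Finset.range T, C.batchSize τ with hn
  have e : ∑ t ∈ Finset.range T, ∑ i ∈ Finset.range (C.batchSize t),
      (if z t i = (s, a, x) then (1 : ENNReal) else 0)
      = ENNReal.ofReal (∑ t ∈ Finset.range T, ∑ i ∈ Finset.range (C.batchSize t),
        (if z t i = (s, a, x) then (1 : ℝ) else 0)) := by
    have h0 : ∀ t i, 0 ≤ if z t i = (s, a, x) then (1 : ℝ) else 0 := fun t i => by
      split_ifs <;> simp
    rw [ENNReal.ofReal_sum_of_nonneg fun t _ => Finset.sum_nonneg fun i _ => h0 t i]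
    refine Finset.sum_congr rfl fun t _ => ?_
    rw [ENNReal.ofReal_sum_of_nonneg fun i _ => h0 t i]
    refine Finset.sum_congr rfl fun i _ => ?_
    split_ifs <;> simp
  refine (le_of_eq ?_).trans (e.le.trans (ENNReal.ofReal_le_ofReal ?_))
  · exact Finset.sum_congr rfl fun t _ => Finset.sum_congr rfl fun i _ => by congr
  · rw [sum_range_flatten fun t i => if z t i = (s, a, x) then (1 : ℝ) else 0]
    have h1 := Finset.single_le_sum (f := fun y => posterior C.prior w n s a y)
      (fun y _ => (posterior_pos hprior w n s a y).le) (Finset.mem_univ x)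
    refine le_trans ?_ (h1.trans (hb n).le)
    exact le_add_of_nonneg_left (hprior s a x).le

variable [Nonempty S] [Finite A] [MeasurableSpace Ω] {μ : Measure Ω} [IsProbabilityMeasure μ]
  {pc : S → A → S → ℝ} {Z : ℕ → ℕ → Ω → S × A × S}

/-- The posterior distributions concentrate near the true transition laws. -/
theorem ae_tendsto_dirichlet_model (hprior : ∀ s a s', 0 < C.prior s a s')
    (hpc : ∀ s a, pc s a ∈ stdSimplex ℝ S) (hZ : IsObservationStream μ C pc Z)
    (hc : Tendsto (fun t => ∑ τ ∈ Finset.range t, C.batchSize τ) atTop atTop)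
    (hinf : ∀ᵐ ω ∂μ, ∀ s a, (⨆ s', totalCount C (fun t i => Z t i ω) s a s') = ⊤) :
    ∀ᵐ ω ∂μ, ∀ s a, ∀ ε > 0, Tendsto (fun t =>
      (dirichlet ((model C (fun t i => Z t i ω) t).param s a)).real (simplexNhd (pc s a) ε)ᶜ)
      atTop (𝓝 0) := by
  have := Fintype.ofFinite A
  have hw : ∀ m, (fun ω => flatten C.batchSize (fun t i => Z t i ω) m) = flatten C.batchSize Z m :=
    fun m => rfl
  have hmean : ∀ᵐ ω ∂μ, ∀ s a x,
      Tendsto (fun m => ∑ y, posterior C.prior (flatten C.batchSize (fun t i => Z t i ω)) m s a y)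
        atTop atTop →
      Tendsto (fun m => posterior C.prior (flatten C.batchSize (fun t i => Z t i ω)) m s a x /
        ∑ y, posterior C.prior (flatten C.batchSize (fun t i => Z t i ω)) m s a y)
        atTop (𝓝 (pc s a x)) := by
    refine ae_all_iff.2 fun s => ae_all_iff.2 fun a => ae_all_iff.2 fun x => ?_
    refine ae_tendsto_posteriorMean hprior (observationFiltration hZ hc)
      (w := flatten C.batchSize Z) hpc (fun m => ?_) (fun m => ?_) (fun m y => ?_) s a x
    · obtain ⟨l, hl, e⟩ := exists_eq_block_add hc m
      exact measurable_pastObservations (by omega) (blockOf_lt_or hc (Nat.lt_succ_self m))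
    · exact (comap_measurable _).mono le_sup_right le_rfl
    · obtain ⟨l, hl, e⟩ := exists_eq_block_add hc m
      exact hZ.law _ _ (by omega) y
  filter_upwards [hmean, hinf] with ω hmean hinf s a ε hε
  -- A supremum over finitely many successors is attained, so a single one is seen infinitely often.
  obtain ⟨x, hx⟩ := exists_eq_ciSup_of_finite
    (f := fun s' => totalCount C (fun t i => Z t i ω) s a s')
  rw [hinf s a] at hx
  have hΦ := tendsto_sum_posterior hprior hx
  simp_rw [model_param]
  exact tendsto_dirichlet_compl_simplexNhd (fun t x => posterior_pos hprior _ _ s a x)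
    (hΦ.comp hc) (fun x => (hmean s a x hΦ).comp hc) hε

end Consistency

/-! ### Monte Carlo noise -/

section Sampling

/-- The fraction of the samples `p 0, …, p (n - 1)` outside `U`. -/
def missFraction {E : Type*} (U : Set E) (n : ℕ) (p : ℕ → E) : ℝ :=
  (∑ j ∈ Finset.range n, Uᶜ.indicator (fun _ => (1 : ℝ)) (p j)) / n

theorem missFraction_nonneg {E : Type*} (U : Set E) (n : ℕ) (p : ℕ → E) :
    0 ≤ missFraction U n p :=
  div_nonneg (Finset.sum_nonneg fun _ _ => Set.indicator_nonneg (fun _ _ => zero_le_one) _)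
    n.cast_nonneg

theorem missFraction_le_one {E : Type*} (U : Set E) (n : ℕ) (p : ℕ → E) :
    missFraction U n p ≤ 1 := by
  refine div_le_one_of_le₀ ?_ n.cast_nonneg
  refine (Finset.sum_le_card_nsmul _ _ 1 fun j _ =>
    Set.indicator_le_self' (fun _ _ => zero_le_one) _).trans ?_
  simp

/-- For random `n` this is a sum over a deterministic range, of which conditional expectations can
be taken term by term. -/
theorem missFraction_eq_sum {E : Type*} (U : Set E) {n N : ℕ} (hn : n ≤ N) (p : ℕ → E) :
    missFraction U n p = ∑ j ∈ Finset.range N,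
      (n : ℝ)⁻¹ * ({j | j < n ∧ p j ∉ U}.indicator (fun _ => (1 : ℝ)) j) := by
  classical
  rw [missFraction, div_eq_inv_mul, ← Finset.mul_sum]
  congr 1
  rw [← Finset.sum_subset (Finset.range_subset_range.2 hn)]
  · refine Finset.sum_congr rfl fun j hj => ?_
    simp [Set.indicator, Finset.mem_range.1 hj]
  · intro j _ hj
    simp only [Finset.mem_range] at hj
    simp [Set.indicator, hj]

variable {S A Ω : Type*} [Fintype S] [Nonempty S] [Fintype A] [MeasurableSpace Ω]
  {μ : Measure Ω} [IsProbabilityMeasure μ] {C : Input S A} {pc : S → A → S → ℝ}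
  {Z : ℕ → ℕ → Ω → S × A × S} {P : ℕ → S → A → ℕ → Ω → S → ℝ}

/-- The model that is used for update `k`. -/
abbrev stepModel (C : Input S A) (Z : ℕ → ℕ → Ω → S × A × S) (k : ℕ) (ω : Ω) : Model S A :=
  model C (fun t i => Z t i ω) (blockOf C.steps k + 1)

omit [Fintype S] [Nonempty S] [Fintype A] [MeasurableSpace Ω] in
theorem measurable_pastSamples_observation (k : ℕ) {t i : ℕ} (hi : i < C.batchSize t) :
    Measurable[pastSamples C Z P k, ⊤] (Z t i) := by
  refine (comap_measurable (Z t i)).mono (le_sup_of_le_left ?_) le_rfl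
  exact le_iSup_of_le t (le_iSup_of_le i (le_iSup_of_le hi le_rfl))

omit [Fintype S] [Nonempty S] [Fintype A] [MeasurableSpace Ω] in
theorem measurable_pastSamples_sample {k k' : ℕ} (h : k' < k) (s : S) (a : A) (j : ℕ) :
    Measurable[pastSamples C Z P k] (P k' s a j) := by
  refine (comap_measurable (P k' s a j)).mono (le_sup_of_le_right ?_) le_rfl
  exact le_iSup_of_le k' (le_iSup_of_le h (le_iSup_of_le s (le_iSup_of_le a
    (le_iSup_of_le j le_rfl))))

/-- The information that precedes each update. -/
def sampleFiltration (hZ : IsObservationStream μ C pc Z) (hP : IsPosteriorSampling μ C Z P) :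
    Filtration ℕ ‹MeasurableSpace Ω› where
  seq := pastSamples C Z P
  mono' k k' hk := by
    refine sup_le_sup_left (iSup_le fun i => iSup_le fun hi => iSup_le fun s => iSup_le fun a =>
      iSup_le fun j => ?_) _
    exact le_iSup_of_le i (le_iSup_of_le (lt_of_lt_of_le hi hk) (le_iSup_of_le s
      (le_iSup_of_le a (le_iSup_of_le j le_rfl))))
  le' k := by
    refine sup_le (iSup_le fun t => iSup_le fun i => iSup_le fun h =>
      (hZ.measurable h).comap_le) ?_
    exact iSup_le fun i => iSup_le fun hi => iSup_le fun s => iSup_le fun a =>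
      iSup_le fun j => (hP.measurable i s a j).comap_le

omit [Nonempty S] [MeasurableSpace Ω] in
theorem measurable_stepModel
    (hc : Tendsto (fun t => ∑ τ ∈ Finset.range t, C.batchSize τ) atTop atTop) (k k' : ℕ) :
    Measurable[pastSamples C Z P k, ⊤] (stepModel C Z k') :=
  measurable_model hc (fun _ _ hi => measurable_pastSamples_observation k hi) _

/-- The conditional probability that a sample is drawn and misses `U`. -/
theorem condExp_miss (hprior : ∀ s a s', 0 < C.prior s a s')
    (hZ : IsObservationStream μ C pc Z) (hP : IsPosteriorSampling μ C Z P)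
    (hc : Tendsto (fun t => ∑ τ ∈ Finset.range t, C.batchSize τ) atTop atTop)
    (hs : Tendsto (fun t => ∑ τ ∈ Finset.range t, C.steps τ) atTop atTop) (k : ℕ) (s : S) (a : A)
    (j : ℕ) {U : Set (S → ℝ)} (hU : MeasurableSet U) :
    μ⟦{ω | j < (stepModel C Z k ω).size s a ∧ P k s a j ω ∉ U} | pastSamples C Z P k⟧ =ᵐ[μ]
      fun ω => if j < (stepModel C Z k ω).size s a then
        (dirichlet ((stepModel C Z k ω).param s a)).real Uᶜ else 0 := by
  classical
  have hle : pastSamples C Z P k ≤ ‹MeasurableSpace Ω› := (sampleFiltration hZ hP).le k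
  obtain ⟨l, hl, e⟩ := exists_eq_block_add hs k
  -- A constraint on one sample only: all other factors of the product law are one.
  have hlaw := hP.law (blockOf C.steps k) l hl
    (fun s' a' j' => if s' = s ∧ a' = a ∧ j' = j then U else Set.univ)
    (fun s' a' j' => by
      split_ifs
      · exact hU
      · exact MeasurableSet.univ)
  have e' : stepsBefore C (blockOf C.steps k) + l = k := e.symm
  rw [e'] at hlaw
  have hset : {ω | ∀ s' a', ∀ j' < (stepModel C Z k ω).size s' a',
      P k s' a' j' ω ∈ (if s' = s ∧ a' = a ∧ j' = j then U else Set.univ)}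
      = {ω | j < (stepModel C Z k ω).size s a ∧ P k s a j ω ∉ U}ᶜ := by
    ext ω
    simp only [Set.mem_ofPred_eq, Set.mem_compl_iff, not_and, not_not]
    constructor
    · intro h hj
      simpa using h s a j hj
    · intro h s' a' j' hj'
      split_ifs with h'
      · obtain ⟨rfl, rfl, rfl⟩ := h'
        exact h hj'
      · trivial
  set T := {ω | j < (stepModel C Z k ω).size s a ∧ P k s a j ω ∉ U} with hT
  have hTm : MeasurableSet T := by
    refine MeasurableSet.inter (s₁ := {ω | j < (stepModel C Z k ω).size s a}) ?_ ?_
    · exact hle _ (measurable_stepModel (C := C) (P := P) hc k k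
        (MeasurableSpace.measurableSet_top (s := {M : Model S A | j < M.size s a})))
    · exact hP.measurable k s a j hU.compl
  rw [hset] at hlaw
  -- The sampling law describes the event that the sample, if drawn, lies in `U`. The miss event is
  -- its complement.
  have hind : T.indicator (fun _ => (1 : ℝ)) = (fun _ => 1) - Tᶜ.indicator (fun _ => (1 : ℝ)) := by
    ext ω
    by_cases h : ω ∈ T <;> simp [h]
  have hsub := condExp_sub (μ := μ) (integrable_const (1 : ℝ))
    ((integrable_const (1 : ℝ)).indicator hTm.compl) (pastSamples C Z P k)
  rw [condExp_const hle, ← hind] at hsub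
  filter_upwards [hsub, hlaw] with ω h1 h2
  rw [h1, Pi.sub_apply, h2]
  have hpos : ∀ s' a' x, 0 < (stepModel C Z k ω).param s' a' x := fun s' a' x => by
    rw [model_param]
    exact posterior_pos hprior _ _ s' a' x
  have hprob := fun s' a' => isProbabilityMeasure_dirichlet (hpos s' a')
  have := hprob s a
  have hprod : (∏ s', ∏ a', ∏ j' ∈ Finset.range ((stepModel C Z k ω).size s' a'),
      (dirichlet ((stepModel C Z k ω).param s' a')).real
        (if s' = s ∧ a' = a ∧ j' = j then U else Set.univ))
      = if j < (stepModel C Z k ω).size s a then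
        (dirichlet ((stepModel C Z k ω).param s a)).real U else 1 := by
    rw [Finset.prod_eq_single s, Finset.prod_eq_single a]
    · split_ifs with hj
      · rw [Finset.prod_eq_single j]
        · simp
        · intro j' _ hj'
          have := hprob s a
          simp [hj']
        · exact fun h => absurd (Finset.mem_range.2 hj) h
      · refine Finset.prod_eq_one fun j' hj' => ?_
        have hne : j' ≠ j := by
          rintro rfl
          exact hj (Finset.mem_range.1 hj')
        simp [hne]
    · intro a' _ ha'
      have := hprob s a'
      simp [ha']
    · simp
    · intro s' _ hs'
      refine Finset.prod_eq_one fun a' _ => ?_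
      have := hprob s' a'
      simp [hs']
    · simp
  rw [hprod]
  split_ifs
  · rw [probReal_compl_eq_one_sub hU]
  · simp

/-- The samples are probability distributions. -/
theorem ae_mem_stdSimplex (hprior : ∀ s a s', 0 < C.prior s a s')
    (hZ : IsObservationStream μ C pc Z) (hP : IsPosteriorSampling μ C Z P)
    (hc : Tendsto (fun t => ∑ τ ∈ Finset.range t, C.batchSize τ) atTop atTop)
    (hs : Tendsto (fun t => ∑ τ ∈ Finset.range t, C.steps τ) atTop atTop) :
    ∀ᵐ ω ∂μ, ∀ k s a, ∀ j < (stepModel C Z k ω).size s a, P k s a j ω ∈ stdSimplex ℝ S := by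
  refine ae_all_iff.2 fun k => ae_all_iff.2 fun s => ae_all_iff.2 fun a => ae_all_iff.2 fun j => ?_
  have hle : pastSamples C Z P k ≤ ‹MeasurableSpace Ω› := (sampleFiltration hZ hP).le k
  have h := condExp_miss hprior hZ hP hc hs k s a j measurableSet_stdSimplex
  set T := {ω | j < (stepModel C Z k ω).size s a ∧ P k s a j ω ∉ stdSimplex ℝ S} with hT
  have hTm : MeasurableSet T := by
    refine MeasurableSet.inter (s₁ := {ω | j < (stepModel C Z k ω).size s a}) ?_ ?_
    · exact hle _ (measurable_stepModel (C := C) (P := P) hc k k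
        (MeasurableSpace.measurableSet_top (s := {M : Model S A | j < M.size s a})))
    · exact hP.measurable k s a j measurableSet_stdSimplex.compl
  have h0 : μ⟦T | pastSamples C Z P k⟧ =ᵐ[μ] 0 := by
    filter_upwards [h] with ω hω
    rw [hω]
    split_ifs
    · rw [measureReal_def]
      have : dirichlet ((stepModel C Z k ω).param s a) (stdSimplex ℝ S)ᶜ = 0 :=
        ae_dirichlet_mem_stdSimplex _
      simp [this]
    · rfl
  have h1 := integral_condExp (μ := μ) (f := T.indicator fun _ => (1 : ℝ)) hle
  rw [integral_congr_ae h0, integral_indicator_const _ hTm] at h1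
  have h2 : μ T = 0 := by
    simpa [measureReal_def, ENNReal.toReal_eq_zero_iff] using h1.symm
  filter_upwards [measure_eq_zero_iff_ae_notMem.1 h2] with ω hω hj
  by_contra hmem
  exact hω ⟨hj, hmem⟩

/-- The Monte Carlo noise of the miss fractions is summable against the learning rates. -/
theorem ae_tendsto_sum_missFraction (hprior : ∀ s a s', 0 < C.prior s a s') (hN : 1 ≤ C.minSize)
    (hrate₀ : ∀ k, 0 ≤ C.rate k) (hrate_sq : Summable fun k => C.rate k ^ 2)
    (hZ : IsObservationStream μ C pc Z) (hP : IsPosteriorSampling μ C Z P)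
    (hc : Tendsto (fun t => ∑ τ ∈ Finset.range t, C.batchSize τ) atTop atTop)
    (hs : Tendsto (fun t => ∑ τ ∈ Finset.range t, C.steps τ) atTop atTop) (s : S) (a : A)
    {U : Set (S → ℝ)} (hU : MeasurableSet U) :
    ∀ᵐ ω ∂μ, ∃ l, Tendsto (fun n => ∑ k ∈ Finset.range n, C.rate k *
      (missFraction U ((stepModel C Z k ω).size s a) (fun j => P k s a j ω)
        - (dirichlet ((stepModel C Z k ω).param s a)).real Uᶜ)) atTop (𝓝 l) := by
  classical
  set ℱ := sampleFiltration hZ hP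
  have hpos : ∀ k ω x, 0 < (stepModel C Z k ω).param s a x := fun k ω x => by
    rw [model_param]
    exact posterior_pos hprior _ _ s a x
  set D : ℕ → Ω → ℝ := fun k ω => (dirichlet ((stepModel C Z k ω).param s a)).real Uᶜ with hD
  set f : ℕ → Ω → ℝ := fun k ω =>
    missFraction U ((stepModel C Z k ω).size s a) (fun j => P k s a j ω) with hf
  set T : ℕ → ℕ → Set Ω := fun k j =>
    {ω | j < (stepModel C Z k ω).size s a ∧ P k s a j ω ∉ U} with hT
  set g : ℕ → Ω → ℝ := fun k ω => ((stepModel C Z k ω).size s a : ℝ)⁻¹ with hg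
  have hTm : ∀ k j, MeasurableSet[ℱ (k + 1)] (T k j) := fun k j => by
    refine MeasurableSet.inter (s₁ := {ω | j < (stepModel C Z k ω).size s a}) ?_ ?_
    · exact measurable_stepModel (C := C) (P := P) hc (k + 1) k
        (MeasurableSpace.measurableSet_top (s := {M : Model S A | j < M.size s a}))
    · exact measurable_pastSamples_sample (C := C) (Z := Z) (Nat.lt_succ_self k) s a j hU.compl
  have hDm : ∀ k, Measurable[ℱ k] (D k) := fun k =>
    (measurable_from_top : Measurable[⊤] fun M : Model S A =>
      (dirichlet (M.param s a)).real Uᶜ).comp (measurable_stepModel (C := C) (P := P) hc k k)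
  have hgm : ∀ k, Measurable[ℱ k] (g k) := fun k =>
    (measurable_from_top : Measurable[⊤] fun M : Model S A =>
      (M.size s a : ℝ)⁻¹).comp (measurable_stepModel (C := C) (P := P) hc k k)
  have hn1 : ∀ k ω, 1 ≤ (stepModel C Z k ω).size s a := fun k ω =>
    hN.trans (minSize_le_model_size C _ _ s a)
  have hg1 : ∀ k ω, ‖g k ω‖ ≤ 1 := fun k ω => by
    have : (1 : ℝ) ≤ (stepModel C Z k ω).size s a := by exact_mod_cast hn1 k ω
    rw [hg, Real.norm_of_nonneg (by positivity)]
    exact inv_le_one_of_one_le₀ this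
  set N : ℕ → ℕ := fun k =>
    C.minSize + ∑ τ ∈ Finset.range (blockOf C.steps k + 1), C.batchSize τ with hNdef
  have hnN : ∀ k ω, (stepModel C Z k ω).size s a ≤ N k := fun k ω => model_size_le C _ _ s a
  have hfe : ∀ k, f k = ∑ j ∈ Finset.range (N k), g k * (T k j).indicator fun _ => (1 : ℝ) :=
    fun k => by
      ext ω
      simp only [hf, missFraction_eq_sum U (hnN k ω), Finset.sum_apply, Pi.mul_apply]
      rfl
  have hfm : ∀ k, Measurable[ℱ (k + 1)] (f k) := fun k => by
    have e : f k = fun ω => ∑ j ∈ Finset.range (N k),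
        (g k * (T k j).indicator fun _ => (1 : ℝ)) ω := by
      rw [hfe]
      ext ω
      rw [Finset.sum_apply]
    rw [e]
    exact Finset.measurable_fun_sum _ fun j _ => ((hgm k).mono (ℱ.mono (Nat.le_succ k)) le_rfl).mul
      ((@measurable_const _ _ _ (ℱ (k + 1)) _).indicator (hTm k j))
  have hTi : ∀ k j, Integrable ((T k j).indicator fun _ => (1 : ℝ)) μ := fun k j =>
    (integrable_const (1 : ℝ)).indicator (ℱ.le _ _ (hTm k j))
  have hgT : ∀ k j, Integrable (g k * (T k j).indicator fun _ => (1 : ℝ)) μ := fun k j =>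
    (hTi k j).bdd_mul ((hgm k).mono (ℱ.le k) le_rfl).aestronglyMeasurable (ae_of_all _ (hg1 k))
  -- Given the past, size and posterior are known, and each of the drawn samples misses with
  -- probability `D k`. Linearity suffices; independence within an update plays no role.
  have hfc : ∀ k, μ[f k | ℱ k] =ᵐ[μ] D k := fun k => by
    have h1 := condExp_finsetSum (μ := μ) (s := Finset.range (N k)) (fun j _ => hgT k j) (ℱ k)
    rw [← hfe] at h1
    have h2 : ∀ᵐ ω ∂μ, ∀ j, μ[g k * (T k j).indicator fun _ => (1 : ℝ) | ℱ k] ω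
        = g k ω * if j < (stepModel C Z k ω).size s a then D k ω else 0 := by
      refine ae_all_iff.2 fun j => ?_
      filter_upwards [condExp_stronglyMeasurable_mul_of_bound (ℱ.le k) (hgm k).stronglyMeasurable
        (hTi k j) 1 (ae_of_all _ (hg1 k)), condExp_miss hprior hZ hP hc hs k s a j hU]
        with ω h h'
      rw [h, Pi.mul_apply]
      congr 1
    filter_upwards [h1, h2] with ω h1 h2
    rw [h1, Finset.sum_apply, Finset.sum_congr rfl fun j _ => h2 j, ← Finset.mul_sum,
      ← Finset.sum_filter]
    have e : (Finset.range (N k)).filter (· < (stepModel C Z k ω).size s a)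
        = Finset.range ((stepModel C Z k ω).size s a) := by
      ext j
      have := hnN k ω
      simp only [Finset.mem_filter, Finset.mem_range]
      omega
    have hne : ((stepModel C Z k ω).size s a : ℝ) ≠ 0 := by
      have := hn1 k ω
      positivity
    rw [e, Finset.sum_const, Finset.card_range, nsmul_eq_mul]
    exact inv_mul_cancel_left₀ hne _
  have hD0 : ∀ k ω, 0 ≤ D k ω := fun k ω => measureReal_nonneg
  have hD1 : ∀ k ω, D k ω ≤ 1 := fun k ω => by
    have := isProbabilityMeasure_dirichlet (hpos k ω)
    exact measureReal_le_one
  have hfD : ∀ k ω, |C.rate k * (f k ω - D k ω)| ≤ C.rate k := fun k ω => by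
    rw [abs_mul, abs_of_nonneg (hrate₀ k)]
    refine mul_le_of_le_one_right (hrate₀ k) ?_
    have h1 := missFraction_nonneg U ((stepModel C Z k ω).size s a) (fun j => P k s a j ω)
    have h2 := missFraction_le_one U ((stepModel C Z k ω).size s a) (fun j => P k s a j ω)
    have h3 := hD0 k ω
    have h4 := hD1 k ω
    rw [abs_le]
    constructor <;> simp only [hf] <;> linarith
  have hfi : ∀ k, Integrable (f k) μ := fun k => by
    rw [hfe]
    exact integrable_finsetSum' _ fun j _ => hgT k j
  have hDi : ∀ k, Integrable (D k) μ := fun k =>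
    Integrable.of_bound ((hDm k).mono (ℱ.le k) le_rfl).aestronglyMeasurable 1
      (ae_of_all _ fun ω => by
        rw [Real.norm_of_nonneg (hD0 k ω)]
        exact hD1 k ω)
  refine ae_tendsto_sum_of_condExp_eq_zero ℱ
    (x := fun k ω => C.rate k * (f k ω - D k ω)) (fun k => ?_) hfD (fun k => ?_)
    (R := ∑' k, C.rate k ^ 2) (fun n ω => ?_)
  · exact (((hfm k).sub ((hDm k).mono (ℱ.mono (Nat.le_succ k)) le_rfl)).const_mul
      _).stronglyMeasurable
  · have h1 := condExp_smul (μ := μ) (C.rate k) (f k - D k) (ℱ k)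
    have h2 := condExp_sub (hfi k) (hDi k) (ℱ k)
    rw [condExp_of_stronglyMeasurable (ℱ.le k) (hDm k).stronglyMeasurable (hDi k)] at h2
    filter_upwards [h1, h2, hfc k] with ω h1 h2 h3
    change μ[C.rate k • (f k - D k) | ℱ k] ω = 0
    rw [h1, Pi.smul_apply, h2, Pi.sub_apply, h3, sub_self, smul_zero]
  · refine (Finset.sum_le_sum fun k _ => ?_).trans
      (hrate_sq.sum_le_tsum (Finset.range n) fun k _ => sq_nonneg _)
    rw [← sq_abs]
    exact pow_le_pow_left₀ (abs_nonneg _) (hfD k ω) 2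

end Sampling

/-! ### Contraction and sensitivity of the backups -/

section Bellman

variable {S A : Type*} [Fintype S] [Fintype A] [Nonempty A] {r : S → A → S → ℝ} {γ : ℝ}

omit [Fintype S] [Fintype A] in
theorem iSup_le_iSup_add [Finite A] {f g : A → ℝ} {D : ℝ} (h : ∀ b, |f b - g b| ≤ D) :
    ⨆ b, f b ≤ (⨆ b, g b) + D :=
  ciSup_le fun b => by
    have h1 := le_ciSup (Set.finite_range g).bddAbove b
    have h2 := (le_abs_self _).trans (h b)
    linarith

theorem abs_iSup_sub_iSup_le {f g : A → ℝ} {D : ℝ} (h : ∀ b, |f b - g b| ≤ D) :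
    |(⨆ b, f b) - ⨆ b, g b| ≤ D := by
  have h1 := iSup_le_iSup_add h
  have h2 := iSup_le_iSup_add (f := g) (g := f) fun b => by
    rw [abs_sub_comm]
    exact h b
  rw [abs_le]
  constructor <;> linarith

/-- Maxima are nonexpansive and `p` has mass one. The law `p` is arbitrary, so the bound holds for
each sampled law. -/
theorem abs_backup_sub_le (hγ : 0 ≤ γ) (Q Q' : S → A → ℝ) (s : S) (a : A) {p : S → ℝ}
    (hp : p ∈ stdSimplex ℝ S) :
    |backup r γ Q s a p - backup r γ Q' s a p| ≤ γ * ‖Q - Q'‖ := by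
  have e : backup r γ Q s a p - backup r γ Q' s a p
      = ∑ s', p s' * (γ * ((⨆ b, Q s' b) - ⨆ b, Q' s' b)) := by
    rw [backup, backup, ← Finset.sum_sub_distrib]
    exact Finset.sum_congr rfl fun s' _ => by ring
  rw [e]
  calc _ ≤ ∑ s', p s' * (γ * ‖Q - Q'‖) := by
        refine (Finset.abs_sum_le_sum_abs _ _).trans (Finset.sum_le_sum fun s' _ => ?_)
        rw [abs_mul, abs_mul, abs_of_nonneg (hp.1 s'), abs_of_nonneg hγ]
        have := hp.1 s'
        gcongr
        exact abs_iSup_sub_iSup_le fun b =>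
          (norm_le_pi_norm ((Q - Q') s') b).trans (norm_le_pi_norm (Q - Q') s')
    _ = γ * ‖Q - Q'‖ := by rw [← Finset.sum_mul, hp.2, one_mul]

/-- The Bellman equation has exactly one solution. -/
theorem exists_unique_isOptimalQ (hγ₀ : 0 ≤ γ) (hγ₁ : γ < 1) {pc : S → A → S → ℝ}
    (hpc : ∀ s a, pc s a ∈ stdSimplex ℝ S) :
    ∃ Qc : S → A → ℝ, ∀ Q : S → A → ℝ, IsOptimalQ r γ pc Q ↔ Q = Qc := by
  set T : (S → A → ℝ) → S → A → ℝ := fun Q s a => backup r γ Q s a (pc s a) with hT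
  have hcontr : ContractingWith ⟨γ, hγ₀⟩ T := by
    refine ⟨by exact_mod_cast hγ₁, LipschitzWith.of_dist_le_mul fun Q Q' => ?_⟩
    rw [dist_eq_norm, dist_eq_norm]
    have h0 : 0 ≤ γ * ‖Q - Q'‖ := by positivity
    refine (pi_norm_le_iff_of_nonneg h0).2 fun s => (pi_norm_le_iff_of_nonneg h0).2 fun a => ?_
    exact abs_backup_sub_le hγ₀ Q Q' s a (hpc s a)
  refine ⟨hcontr.fixedPoint, fun Q => ⟨fun h => ?_, ?_⟩⟩
  · refine hcontr.fixedPoint_unique ?_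
    ext s a
    exact (h s a).symm
  · rintro rfl s a
    exact (congrFun (congrFun hcontr.fixedPoint_isFixedPt.symm s) a)

/-- A bound for the sensitivity of the backups of `Q` to the transition probabilities. -/
def backupBound (r : S → A → S → ℝ) (γ : ℝ) (Q : S → A → ℝ) : ℝ :=
  ∑ s, ∑ a, ∑ s', |r s a s' + γ * ⨆ b, Q s' b|

omit [Nonempty A] in
theorem backupBound_nonneg (r : S → A → S → ℝ) (γ : ℝ) (Q : S → A → ℝ) :
    0 ≤ backupBound r γ Q := by
  unfold backupBound
  positivity

-- This is applied only at the fixed function `Qc`, so the constant does not change with the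
-- iterates and no bound on them is needed.
omit [Nonempty A] in
theorem abs_backup_sub_backup_le (Q : S → A → ℝ) (s : S) (a : A) {p q : S → ℝ} {δ : ℝ}
    (hδ : 0 ≤ δ) (hpq : ∀ s', |p s' - q s'| ≤ δ) :
    |backup r γ Q s a p - backup r γ Q s a q| ≤ backupBound r γ Q * δ := by
  have e : backup r γ Q s a p - backup r γ Q s a q
      = ∑ s', (p s' - q s') * (r s a s' + γ * ⨆ b, Q s' b) := by
    rw [backup, backup, ← Finset.sum_sub_distrib]
    exact Finset.sum_congr rfl fun s' _ => by ring
  have h1 : ∑ s', |r s a s' + γ * ⨆ b, Q s' b| ≤ backupBound r γ Q :=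
    (Finset.single_le_sum (f := fun a => ∑ s', |r s a s' + γ * ⨆ b, Q s' b|)
      (fun a _ => by positivity) (Finset.mem_univ a)).trans
      (Finset.single_le_sum (f := fun s => ∑ a, ∑ s', |r s a s' + γ * ⨆ b, Q s' b|)
      (fun s _ => by positivity) (Finset.mem_univ s))
  rw [e]
  calc _ ≤ ∑ s', δ * |r s a s' + γ * ⨆ b, Q s' b| := by
        refine (Finset.abs_sum_le_sum_abs _ _).trans (Finset.sum_le_sum fun s' _ => ?_)
        rw [abs_mul]
        exact mul_le_mul_of_nonneg_right (hpq s') (abs_nonneg _)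
    _ = (∑ s', |r s a s' + γ * ⨆ b, Q s' b|) * δ := by rw [← Finset.mul_sum, mul_comm]
    _ ≤ _ := by gcongr

end Bellman

/-! ### The error recursion of the Q-functions -/

section QLearning

variable {S A : Type*} [Fintype S] {C : Input S A}

/-- The Q-function after `k` updates. -/
def flatQ (C : Input S A) (z : ℕ → ℕ → S × A × S) (p : ℕ → S → A → ℕ → S → ℝ) : ℕ → S → A → ℝ
  | 0 => fun _ _ => 0
  | k + 1 => qUpdate C (model C z (blockOf C.steps k + 1)).size (C.rate k) (p k) (flatQ C z p k)

theorem qFunction_eq_flatQ (z : ℕ → ℕ → S × A × S) (p : ℕ → S → A → ℕ → S → ℝ) (t : ℕ) :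
    qFunction C z p t = flatQ C z p (stepsBefore C t) :=
  eq_of_foldl_blocks (c := C.steps) (x := qFunction C z p) (y := flatQ C z p)
    (F := fun t l Q => qUpdate C (model C z (t + 1)).size (C.rate (stepsBefore C t + l))
        (p (stepsBefore C t + l)) Q) rfl (fun t => rfl)
    (fun t l hl => by rw [flatQ, blockOf_add hl]; rfl) t

variable [Fintype A] [Nonempty A] {pc : S → A → S → ℝ} {Qc : S → A → ℝ}

theorem abs_le_one_of_mem_stdSimplex {p q : S → ℝ} (hp : p ∈ stdSimplex ℝ S)
    (hq : q ∈ stdSimplex ℝ S) (s : S) : |p s - q s| ≤ 1 := by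
  have h : ∀ p ∈ stdSimplex ℝ S, p s ≤ 1 := fun p hp => by
    rw [← hp.2]
    exact Finset.single_le_sum (fun i _ => hp.1 i) (Finset.mem_univ s)
  have h1 := h p hp
  have h2 := h q hq
  have h3 := hp.1 s
  have h4 := hq.1 s
  rw [abs_le]
  constructor <;> linarith

/-- The error of the risk estimate for one state-action pair. -/
theorem abs_riskEstimate_backup_sub_le (hγ₀ : 0 ≤ C.discount) (hα₀ : 0 < C.level)
    (hα₁ : C.level < 1) (hpc : ∀ s a, pc s a ∈ stdSimplex ℝ S)
    (hQc : IsOptimalQ C.reward C.discount pc Qc) (Q : S → A → ℝ) (s : S) (a : A) {n : ℕ}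
    (hn : 1 ≤ n) {p : ℕ → S → ℝ} (hp : ∀ j < n, p j ∈ stdSimplex ℝ S) {ε : ℝ} (hε : 0 ≤ ε) :
    |riskEstimate C.risk C.level (fun j : Fin n => backup C.reward C.discount Q s a (p j))
      - Qc s a| ≤ C.discount * ‖Q - Qc‖ + backupBound C.reward C.discount Qc * ε
        + (min C.level (1 - C.level))⁻¹ *
          (backupBound C.reward C.discount Qc * missFraction (simplexNhd (pc s a) ε) n p) := by
  set K := backupBound C.reward C.discount Qc with hK
  have hK0 : 0 ≤ K := backupBound_nonneg _ _ _
  have h := abs_riskEstimate_sub_le C.risk hα₀ hα₁ hn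
    (X := fun j : Fin n => backup C.reward C.discount Q s a (p j)) (x := Qc s a)
    (Y := fun j => K * (simplexNhd (pc s a) ε)ᶜ.indicator (fun _ => (1 : ℝ)) (p j))
    (D := C.discount * ‖Q - Qc‖ + K * ε)
    (fun j => mul_nonneg hK0 (Set.indicator_nonneg (fun _ _ => zero_le_one) _)) fun j => by
      have h1 := abs_backup_sub_le (r := C.reward) hγ₀ Q Qc s a (hp j j.2)
      have h2 : |backup C.reward C.discount Qc s a (p j)
          - backup C.reward C.discount Qc s a (pc s a)| ≤
          K * ε + K * (simplexNhd (pc s a) ε)ᶜ.indicator (fun _ => (1 : ℝ)) (p j) := by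
        -- A hit costs `K * ε`. For a miss, coordinates of two distributions differ by at most one,
        -- which costs at most `K`.
        by_cases hU : p j ∈ simplexNhd (pc s a) ε
        · rw [Set.indicator_of_notMem (by simpa using hU), mul_zero, add_zero]
          exact abs_backup_sub_backup_le Qc s a hε fun s' => (hU.2 s').le
        · rw [Set.indicator_of_mem (by simpa using hU)]
          have := abs_backup_sub_backup_le (r := C.reward) (γ := C.discount) Qc s a zero_le_one
            (abs_le_one_of_mem_stdSimplex (hp j j.2) (hpc s a))
          have := mul_nonneg hK0 hε
          linarith
      rw [hQc s a]
      change |_ - backup C.reward C.discount Qc s a (pc s a)| ≤ _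
      have h3 := abs_sub_le (backup C.reward C.discount Q s a (p j))
        (backup C.reward C.discount Qc s a (p j)) (backup C.reward C.discount Qc s a (pc s a))
      linarith
  rw [← Finset.mul_sum, mul_div_assoc, ← Finset.sum_range
    (fun j => (simplexNhd (pc s a) ε)ᶜ.indicator (fun _ => (1 : ℝ)) (p j))] at h
  exact h

/-- Averaging with weight `η` against a `γ`-contraction leaves the factor `1 - (1 - γ) * η`. Summing
the miss fractions over all pairs gives one scalar recursion for the norm. -/
theorem norm_qUpdate_sub_le (hγ₀ : 0 ≤ C.discount) (hα₀ : 0 < C.level)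
    (hα₁ : C.level < 1) (hpc : ∀ s a, pc s a ∈ stdSimplex ℝ S)
    (hQc : IsOptimalQ C.reward C.discount pc Qc) (Q : S → A → ℝ) {size : S → A → ℕ}
    (hsize : ∀ s a, 1 ≤ size s a) {η : ℝ} (hη₀ : 0 ≤ η) (hη₁ : η ≤ 1) {p : S → A → ℕ → S → ℝ}
    (hp : ∀ s a, ∀ j < size s a, p s a j ∈ stdSimplex ℝ S) {ε : ℝ} (hε : 0 ≤ ε) :
    ‖qUpdate C size η p Q - Qc‖ ≤ (1 - (1 - C.discount) * η) * ‖Q - Qc‖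
      + η * (backupBound C.reward C.discount Qc * ε + (min C.level (1 - C.level))⁻¹ *
        backupBound C.reward C.discount Qc *
          ∑ x : S × A, missFraction (simplexNhd (pc x.1 x.2) ε) (size x.1 x.2) (p x.1 x.2)) := by
  set K := backupBound C.reward C.discount Qc with hK
  have hK0 : 0 ≤ K := backupBound_nonneg _ _ _
  have hc : 0 < min C.level (1 - C.level) := lt_min hα₀ (by linarith)
  set F : S × A → ℝ := fun x =>
    missFraction (simplexNhd (pc x.1 x.2) ε) (size x.1 x.2) (p x.1 x.2) with hF
  have hF0 : ∀ x, 0 ≤ F x := fun x => missFraction_nonneg _ _ _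
  have e : (1 - (1 - C.discount) * η) * ‖Q - Qc‖
      + η * (K * ε + (min C.level (1 - C.level))⁻¹ * K * ∑ x, F x)
      = (1 - η) * ‖Q - Qc‖ + η * (C.discount * ‖Q - Qc‖ + K * ε
        + (min C.level (1 - C.level))⁻¹ * (K * ∑ x, F x)) := by ring
  rw [e]
  have h0 : 0 ≤ (1 - η) * ‖Q - Qc‖ + η * (C.discount * ‖Q - Qc‖ + K * ε
        + (min C.level (1 - C.level))⁻¹ * (K * ∑ x, F x)) := by
    have h1 : 0 ≤ 1 - η := by linarith
    have h2 : 0 ≤ ∑ x, F x := Finset.sum_nonneg fun x _ => hF0 x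
    have h3 := mul_nonneg (inv_nonneg.2 hc.le) (mul_nonneg hK0 h2)
    have h4 := mul_nonneg hγ₀ (norm_nonneg (Q - Qc))
    exact add_nonneg (mul_nonneg h1 (norm_nonneg _))
      (mul_nonneg hη₀ (add_nonneg (add_nonneg h4 (mul_nonneg hK0 hε)) h3))
  refine (pi_norm_le_iff_of_nonneg h0).2 fun s => (pi_norm_le_iff_of_nonneg h0).2 fun a => ?_
  have h1 : |Q s a - Qc s a| ≤ ‖Q - Qc‖ :=
    (norm_le_pi_norm ((Q - Qc) s) a).trans (norm_le_pi_norm (Q - Qc) s)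
  have h2 := abs_riskEstimate_backup_sub_le hγ₀ hα₀ hα₁ hpc hQc Q s a (hsize s a) (hp s a) hε
  have h3 : F (s, a) ≤ ∑ x, F x :=
    Finset.single_le_sum (fun x _ => hF0 x) (Finset.mem_univ (s, a))
  have h4 : (qUpdate C size η p Q - Qc) s a = (1 - η) * (Q s a - Qc s a)
      + η * (riskEstimate C.risk C.level (fun j : Fin (size s a) =>
        backup C.reward C.discount Q s a (p s a j)) - Qc s a) := by
    change (1 - η) * Q s a + η * _ - Qc s a = _
    ring
  rw [h4, Real.norm_eq_abs]
  refine (abs_add_le _ _).trans ?_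
  rw [abs_mul, abs_mul, abs_of_nonneg hη₀, abs_of_nonneg (sub_nonneg.2 hη₁)]
  refine add_le_add (mul_le_mul_of_nonneg_left h1 (sub_nonneg.2 hη₁))
    (mul_le_mul_of_nonneg_left (h2.trans (add_le_add_right ?_ _)) hη₀)
  exact mul_le_mul_of_nonneg_left (mul_le_mul_of_nonneg_left h3 hK0) (inv_nonneg.2 hc.le)

/-- Convergence for one realization of the observations and samples. -/
theorem tendsto_norm_flatQ_sub (hγ₀ : 0 ≤ C.discount) (hγ₁ : C.discount < 1)
    (hα₀ : 0 < C.level) (hα₁ : C.level < 1) (hN : 1 ≤ C.minSize)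
    (hrate₀ : ∀ k, 0 ≤ C.rate k) (hrate₁ : ∀ k, C.rate k ≤ 1)
    (hrate_sum : Tendsto (fun K : ℕ => ∑ k ∈ Finset.range K, C.rate k) atTop atTop)
    (hpc : ∀ s a, pc s a ∈ stdSimplex ℝ S) (hQc : IsOptimalQ C.reward C.discount pc Qc)
    {z : ℕ → ℕ → S × A × S} {p : ℕ → S → A → ℕ → S → ℝ}
    (hp : ∀ k s a, ∀ j < (model C z (blockOf C.steps k + 1)).size s a,
      p k s a j ∈ stdSimplex ℝ S)
    {ε : ℕ → ℝ} (hε₀ : ∀ i, 0 < ε i) (hε : Tendsto ε atTop (𝓝 0)) {D : ℕ → S → A → ℕ → ℝ}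
    (hD : ∀ i s a, Tendsto (D i s a) atTop (𝓝 0))
    (hnoise : ∀ i s a, ∃ l, Tendsto (fun n => ∑ k ∈ Finset.range n, C.rate k *
      (missFraction (simplexNhd (pc s a) (ε i)) ((model C z (blockOf C.steps k + 1)).size s a)
        (p k s a) - D i s a k)) atTop (𝓝 l)) :
    Tendsto (fun k => ‖flatQ C z p k - Qc‖) atTop (𝓝 0) := by
  set K := backupBound C.reward C.discount Qc with hK
  set c := (min C.level (1 - C.level))⁻¹ with hc
  set κ := 1 - C.discount with hκ
  have hκ0 : 0 < κ := by linarith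
  have hκ1 : κ ≤ 1 := by linarith
  set F : ℕ → ℕ → S × A → ℝ := fun i k x => missFraction (simplexNhd (pc x.1 x.2) (ε i))
    ((model C z (blockOf C.steps k + 1)).size x.1 x.2) (p k x.1 x.2) with hF
  have hstep : ∀ i k, ‖flatQ C z p (k + 1) - Qc‖ ≤ (1 - κ * C.rate k) * ‖flatQ C z p k - Qc‖
      + C.rate k * (K * ε i + c * K * ∑ x, F i k x) := fun i k =>
    norm_qUpdate_sub_le hγ₀ hα₀ hα₁ hpc hQc _
      (fun s a => hN.trans (minSize_le_model_size C _ _ s a)) (hrate₀ k) (hrate₁ k) (hp k)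
      (hε₀ i).le
  have ha₀ : ∀ k, 0 ≤ κ * C.rate k := fun k => mul_nonneg hκ0.le (hrate₀ k)
  have ha₁ : ∀ k, κ * C.rate k ≤ 1 := fun k => mul_le_one₀ hκ1 (hrate₀ k) (hrate₁ k)
  have hasum : Tendsto (fun n => ∑ k ∈ Finset.range n, κ * C.rate k) atTop atTop := by
    simp_rw [← Finset.mul_sum]
    exact hrate_sum.const_mul_atTop hκ0
  -- The comparison sequence `w` satisfies the error recursion with equality. The miss fractions are
  -- split into their means `D`, which enter `g`, and the noise `b`. Division by `κ` in `g`
  -- compensates for the step size `κ * C.rate k`.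
  have key : ∀ i, ∃ w : ℕ → ℝ, Tendsto w atTop (𝓝 (K * ε i / κ)) ∧
      ∀ k, ‖flatQ C z p k - Qc‖ ≤ w k := fun i => by
    choose l hl using hnoise i
    set g : ℕ → ℝ := fun k => (K * ε i + c * K * ∑ x : S × A, D i x.1 x.2 k) / κ with hg
    set b : ℕ → ℝ := fun k =>
      c * K * ∑ x : S × A, C.rate k * (F i k x - D i x.1 x.2 k) with hb
    set w : ℕ → ℝ := fun k => Nat.rec ‖flatQ C z p 0 - Qc‖
      (fun k v => (1 - κ * C.rate k) * v + κ * C.rate k * g k + b k) k with hw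
    have hw1 : ∀ k, w (k + 1) = (1 - κ * C.rate k) * w k + κ * C.rate k * g k + b k :=
      fun k => rfl
    refine ⟨w, ?_, fun k => ?_⟩
    · refine tendsto_of_averaging_add (g := g) (b := b)
        (c := c * K * ∑ x : S × A, l x.1 x.2) ha₀ ha₁ hasum ?_ ?_ hw1
      · have h1 := tendsto_finsetSum Finset.univ fun (x : S × A) _ => hD i x.1 x.2
        have h2 := ((h1.const_mul (c * K)).const_add (K * ε i)).div_const κ
        simpa using h2
      · have h1 := tendsto_finsetSum Finset.univ fun (x : S × A) _ => hl x.1 x.2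
        refine (h1.const_mul (c * K)).congr fun n => ?_
        simp only [hb]
        rw [← Finset.mul_sum, Finset.sum_comm]
    · induction k with
      | zero => exact le_rfl
      | succ k ih =>
        refine (hstep i k).trans ?_
        have h1 := mul_le_mul_of_nonneg_left ih (sub_nonneg.2 (ha₁ k))
        have h2 : κ * C.rate k * g k + b k
            = C.rate k * (K * ε i + c * K * ∑ x, F i k x) := by
          simp only [hg, hb]
          rw [← Finset.mul_sum, Finset.sum_sub_distrib]
          field_simp
          ring
        rw [hw1]
        linarith
  have hlim : Tendsto (fun i => K * ε i / κ) atTop (𝓝 0) := by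
    simpa using (hε.const_mul K).div_const κ
  refine tendsto_order.2 ⟨fun b hb => Eventually.of_forall fun k => hb.trans_le (norm_nonneg _),
    fun b hb => ?_⟩
  obtain ⟨i, hi⟩ := (hlim.eventually_lt_const hb).exists
  obtain ⟨w, hw, hle⟩ := key i
  filter_upwards [hw.eventually_lt_const hi] with k hk
  exact (hle k).trans_lt hk

end QLearning

end BRQL

end

theorem mainTheorem6 {S A Ω : Type*} [Fintype S] [Nonempty S] [Fintype A] [Nonempty A]
    [MeasurableSpace Ω] (μ : Measure Ω) [IsProbabilityMeasure μ]
    (C : BRQL.Input S A)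
    (hγ₀ : 0 ≤ C.discount) (hγ₁ : C.discount < 1)
    (hα₀ : 0 < C.level) (hα₁ : C.level < 1)
    (hN : 1 ≤ C.minSize)
    (hprior : ∀ s a s', 0 < C.prior s a s')
    (hrate₀ : ∀ k, 0 ≤ C.rate k) (hrate₁ : ∀ k, C.rate k ≤ 1)
    (hrate_sum : Tendsto (fun K : ℕ => ∑ k ∈ Finset.range K, C.rate k) atTop atTop)
    (hrate_sq : Summable fun k => C.rate k ^ 2)
    (hsteps : Tendsto (BRQL.stepsBefore C) atTop atTop)
    (pc : S → A → S → ℝ) (hpc : ∀ s a, pc s a ∈ stdSimplex ℝ S)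
    (Z : ℕ → ℕ → Ω → S × A × S) (hZ : BRQL.IsObservationStream μ C pc Z)
    (P : ℕ → S → A → ℕ → Ω → S → ℝ) (hP : BRQL.IsPosteriorSampling μ C Z P)
    (hinf : ∀ᵐ ω ∂μ, ∀ s a, (⨆ s', BRQL.totalCount C (fun t i => Z t i ω) s a s') = ⊤) :
    ∃ Qc : S → A → ℝ,
      (∀ Q : S → A → ℝ, BRQL.IsOptimalQ C.reward C.discount pc Q ↔ Q = Qc) ∧
      ∀ᵐ ω ∂μ, Tendsto
        (fun t => ‖BRQL.qFunction C (fun t i => Z t i ω) (fun k s a j => P k s a j ω) t - Qc‖)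
        atTop (𝓝 0) := by
  obtain ⟨Qc, hQc⟩ := BRQL.exists_unique_isOptimalQ (r := C.reward) hγ₀ hγ₁ hpc
  refine ⟨Qc, hQc, ?_⟩
  -- Batch sizes are deterministic, so a single good realization shows that their sum diverges.
  have hc : Tendsto (fun t => ∑ τ ∈ Finset.range t, C.batchSize τ) atTop atTop := by
    obtain ⟨ω, hω⟩ := hinf.exists
    obtain ⟨x, hx⟩ := exists_eq_ciSup_of_finite (f := fun s' =>
      BRQL.totalCount C (fun t i => Z t i ω) (Classical.arbitrary S) (Classical.arbitrary A) s')
    exact BRQL.tendsto_sum_batchSize (hx.trans (hω _ _))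
  -- Radii `1 / (i + 1)` form a countable family, which leaves only one null set.
  have hnoise := ae_all_iff.2 fun i : ℕ => ae_all_iff.2 fun s => ae_all_iff.2 fun a =>
    BRQL.ae_tendsto_sum_missFraction hprior hN hrate₀ hrate_sq hZ hP hc hsteps s a
      (BRQL.measurableSet_simplexNhd (pc s a) (1 / ((i : ℝ) + 1)))
  filter_upwards [BRQL.ae_tendsto_dirichlet_model hprior hpc hZ hc hinf,
    BRQL.ae_mem_stdSimplex hprior hZ hP hc hsteps, hnoise] with ω hdir hmem hnoise
  simp_rw [BRQL.qFunction_eq_flatQ]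
  refine Tendsto.comp (g := fun k => ‖BRQL.flatQ C (fun t i => Z t i ω)
    (fun k s a j => P k s a j ω) k - Qc‖) ?_ hsteps
  refine BRQL.tendsto_norm_flatQ_sub hγ₀ hγ₁ hα₀ hα₁ hN hrate₀ hrate₁ hrate_sum hpc
    ((hQc Qc).2 rfl) hmem (fun i => Nat.one_div_pos_of_nat)
    tendsto_one_div_add_atTop_nhds_zero_nat (fun i s a => ?_) hnoise
  -- Update `k` uses the model of stage `blockOf C.steps k + 1`, which tends to infinity with `k`.
  exact (hdir s a _ Nat.one_div_pos_of_nat).comp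
    (tendsto_atTop_mono (fun k => Nat.le_succ _) (BRQL.tendsto_blockOf hsteps))
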